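/- Theorem 3. System F types are generated from type variables $X$ by $T\to U$ and $\forall X.T$, and are taken up to renaming of bound variables. A type is resolved if it has the form $T_1\to\dots\to T_n\to X$ with $n\ge 0$ and $X$ a variable; the types $T_1,\dots,T_n$ are its branches and $X$ is its colour. A quantifier $\forall X$ is available in $T$ if $T=\forall X.U$, or $T=U\to T'$ or $T=\forall Y.T'$ with $\forall X$ available in $T'$. The importation $T\cdot V$ deletes the leftmost available quantifier $\forall X$ of $T$ and substitutes $V$ for $X$; write $T\cdot V_1\dots V_k$ for the iterated importation. Transition system. For a type $T$ let $\Delta_T$ be the deterministic transition system whose states are an initial state $\star$ and the types, and whose labels are the pairs $\langle i,V_1\dots V_k\rangle$ with $i\ge1$, $k\ge0$ and types $V_j$ (the imports). Its transitions are $\star\to T\cdot V_1\dots V_k$ with label $\langle 1,V_1\dots V_k\rangle$, whenever this type is defined and resolved, and $(T_1\to\dots\to T_n\to X)\to T_i\cdot V_1\dots V_k$ with label $\langle i,V_1\dots V_k\rangle$, whenever $1\le i\le n$ and this type is defined and resolved. The colour of a transition is the colour of its target. A trace is the label sequence of a path from $\star$. Dialogues. A dialogue is a finite sequence $\langle\alpha_1,m_1\rangle\dots\langle\alpha_k,m_k\rangle$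 of pairs of a pointer $\alpha_i\in\mathbb N$ and a label $m_i$ with $i-\alpha_i$ odd and positive. The player O makes the moves in odd position and P those in even position. A thread of a dialogue is a sequence $m_{d_1}\dots m_{d_n}$ with $\alpha_{d_1}=0$ and $\alpha_{d_j}=d_{j-1}$ for $1<j\le n$. The P-backtracking game over $\Delta_T$ is the set of the dialogues whose threads are all traces of $\Delta_T$ and in which $\alpha_i=i-1$ for all odd $i$. The black box game for $T$ is its subset of those dialogues in which 1. all imports of O are fresh variables (black boxes); since the names of bound variables carry no meaning, they are chosen canonically: for a fixed enumeration $X_0,X_1,X_2,\dots$ of the variables, O, having imported $n$ black boxes so far, imports $X_n,X_{n+1},\dots$; 2. the free variables of each import of P are among the black boxes imported by O earlier in the dialogue. Strategies. A strategy on a game $G$ (a prefix-closed set of finite sequences that contains the empty one) is a prefix-closed set $\sigma\subseteq G$ that contains the empty sequence and in which each sequence of odd length has a unique one-move extension. It is live if for all $s\in\sigma$ of even length and all moves $m$, $sm\in G$ implies $sm\in\sigma$. It is finite if $\sigma$ is a finite set. It satisfies the copycat condition if, in each of its dialogues, the colour of each P-move (that is, of the associated transition) equals the colour of the O-move immediately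 before it. Claim. Let $T$ be a closed System F type. Then the $\eta$-expanded $\beta$-normal closed terms of type $T$ (up to renaming of bound variables) are in bijection with the finite live strategies on the black box game for $T$ that satisfy the copycat condition. The bijection takes a term $t$ to the set of all dialogues in which P plays according to $t$, as follows. O's first move enters the term $t$. Whenever O's move enters a term, which begins with a maximal prefix of abstractions $\lambda x_1,\dots,\lambda x_m$ and $\Lambda Y_1,\dots,\Lambda Y_k$ (interleaved in some order), O's imports are the black boxes for which $Y_1,\dots,Y_k$ then stand. The body after the prefix is a variable $x$ applied to terms $u_1,\dots,u_r$ and types $V_1,\dots,V_l$ (interleaved in some order). If $x$ is the $b$-th $\lambda$-bound variable of the prefix entered by O's move in position $q$, then P answers $\langle q,\langle b,V_1\dots V_l\rangle\rangle$, and O's next move can have any branch choice $j\in\{1,\dots,r\}$ and then enters $u_j$. -/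

import Mathlib

/-! ## Games, strategies, transition systems, backtracking -/

namespace Backtracking

/-- A tree of traces over `M`: a set of finite sequences that contains the empty sequence and the
predecessor of each of its non-empty elements. A game over `M` is such a tree. -/
def IsTree {M : Type*} (G : Set (List M)) : Prop :=
  [] ∈ G ∧ ∀ s m, s ++ [m] ∈ G → s ∈ G

/-- A strategy for the second player in `G`: a tree `σ ⊆ G` in which each trace of odd length has
a unique one-move extension. -/
def IsStrategy {M : Type*} (G σ : Set (List M)) : Prop :=
  IsTree σ ∧ σ ⊆ G ∧ ∀ s ∈ σ, Odd s.length → ∃! m, s ++ [m] ∈ σ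

/-- A live strategy responds to every stimulus of the first player. -/
def IsLive {M : Type*} (G σ : Set (List M)) : Prop :=
  ∀ s ∈ σ, Even s.length → ∀ m, s ++ [m] ∈ G → s ++ [m] ∈ σ

/-- A deterministic labelled transition system with states `Q` and labels `L`. -/
structure TransitionSystem (Q L : Type*) where
  /-- the partial transition function -/
  step : Q → L → Option Q
  /-- the initial state -/
  init : Q

/-- The state reached from the initial state along a sequence of labels, if all the transitions
exist. -/
def TransitionSystem.run {Q L : Type*} (Δ : TransitionSystem Q L) (s : List L) : Option Q :=
  s.foldlM Δ.step Δ.init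

/-- The game of a transition system: the set of its traces. -/
def TransitionSystem.game {Q L : Type*} (Δ : TransitionSystem Q L) : Set (List L) :=
  {s | ∃ q, Δ.run s = some q}

/-- A dialogue over `M`: a sequence `⟨α₁, m₁⟩ … ⟨αₖ, mₖ⟩` with every `i - αᵢ` odd and positive.
Positions are counted from `1`, so position `i + 1` is the list index `i`; the pointer `0` means
that there is no pointer. -/
def IsDialogue {M : Type*} (d : List (ℕ × M)) : Prop :=
  ∀ i a m, d[i]? = some (a, m) → a ≤ i ∧ Odd (i + 1 - a)

/-- `ThreadTo d j s`: the sequence of moves `s` is the thread of `d` that ends at position `j`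
(the empty thread for `j = 0`). -/
inductive ThreadTo {M : Type*} (d : List (ℕ × M)) : ℕ → List M → Prop
  | nil : ThreadTo d 0 []
  | snoc {i a : ℕ} {m : M} {s : List M} :
      ThreadTo d a s → d[i]? = some (a, m) → ThreadTo d (i + 1) (s ++ [m])

/-- The backtracking game over `G`: the dialogues all of whose threads are in `G`. -/
def backtrack {M : Type*} (G : Set (List M)) : Set (List (ℕ × M)) :=
  {d | IsDialogue d ∧ ∀ j s, ThreadTo d j s → s ∈ G}

/-- The `P`-backtracking game over `G`: each move in an odd position points to the immediately
preceding move (the very first one has no pointer). -/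
def pBacktrack {M : Type*} (G : Set (List M)) : Set (List (ℕ × M)) :=
  {d | d ∈ backtrack G ∧ ∀ i a m, d[i]? = some (a, m) → Odd (i + 1) → a = i}

end Backtracking

/-! ## System F -/

namespace SystemF

/-- System F types up to renaming of bound variables, in locally nameless form: `fvar x` is the
`x`-th type variable, and `bvar i` is bound by the `i`-th enclosing quantifier. The actual types are
the elements without dangling `bvar`s, see `Ty.LC`. -/
inductive Ty : Type
  | fvar (x : ℕ) : Ty
  | bvar (i : ℕ) : Ty
  | arr (A B : Ty) : Ty
  | all (A : Ty) : Ty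
  deriving DecidableEq

namespace Ty

/-- All the `bvar`s that point beyond the quantifiers of the expression are below `k`; in particular
`A.LC 0` says that `A` is a type and `A.LC 1` that `A.all` is one. -/
def LC : Ty → ℕ → Prop
  | fvar _, _ => True
  | bvar i, k => i < k
  | arr A B, k => A.LC k ∧ B.LC k
  | all A, k => A.LC (k + 1)

/-- The set of free type variables. -/
def fv : Ty → Finset ℕ
  | fvar x => {x}
  | bvar _ => ∅
  | arr A B => A.fv ∪ B.fv
  | all A => A.fv

/-- `A.instAt k V` replaces the index `k` by the type `V`. -/
def instAt : Ty → ℕ → Ty → Ty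
  | fvar x, _, _ => fvar x
  | bvar i, k, V => if i = k then V else bvar i
  | arr A B, k, V => arr (A.instAt k V) (B.instAt k V)
  | all A, k, V => all (A.instAt (k + 1) V)

/-- `A.inst V` is `A[V/X]`, where `A` is the body of the quantified type `∀ X. A`. -/
def inst (A V : Ty) : Ty := A.instAt 0 V

/-- `A` is a type whose free variables are among the variables number `0, …, n - 1`. -/
def WF (n : ℕ) (A : Ty) : Prop := A.LC 0 ∧ ∀ x ∈ A.fv, x < n

/-- `A` is a type without free variables. -/
def IsClosed (A : Ty) : Prop := A.LC 0 ∧ A.fv = ∅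

/-- The importation `A · V`: delete the leftmost available quantifier `∀ X` of `A` and substitute
`V` for `X`. It is undefined if no quantifier is available. -/
def imp : Ty → Ty → Option Ty
  | all A, V => some (A.inst V)
  | arr A B, V => (B.imp V).map (arr A)
  | fvar _, _ => none
  | bvar _, _ => none

/-- The iterated importation `A · V₁ V₂ … Vₖ`. -/
def impAll (A : Ty) (Vs : List Ty) : Option Ty := Vs.foldlM imp A

/-- The rightmost variable `X` of a type of the form `T₁ → … → Tₙ → X`. -/
def colour : Ty → Option ℕ
  | fvar x => some x
  | arr _ B => B.colour
  | bvar _ => none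
  | all _ => none

/-- A type is resolved if no quantifier is available in it, that is, if it has the form
`T₁ → … → Tₙ → X`. -/
def Resolved (A : Ty) : Prop := ∃ x, A.colour = some x

/-- The branches `T₁, …, Tₙ` of `T₁ → … → Tₙ → X`. -/
def branches : Ty → List Ty
  | arr A B => A :: B.branches
  | _ => []

open Classical in
/-- The resolved type `A · V₁ … Vₖ`, provided that all the `Vᵢ` are types, that the importations
are defined, and that they resolve `A`. -/
noncomputable def resolve (A : Ty) (Vs : List Ty) : Option Ty :=
  if ∀ V ∈ Vs, V.LC 0 then (A.impAll Vs).filter (fun B => decide B.Resolved) else none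

end Ty

/-- System F terms (Church style) up to renaming of bound variables. Term variables are de Bruijn
indices: `var 0` is bound by the innermost enclosing `lam`. For type variables bound by `tlam` we
use de Bruijn levels: a `tlam` that lies below `n` other `tlam`s binds the type variable `fvar n`
in its body. -/
inductive Tm : Type
  | var (x : ℕ) : Tm
  | lam (A : Ty) (t : Tm) : Tm
  | app (t u : Tm) : Tm
  | tlam (t : Tm) : Tm
  | tapp (t : Tm) (B : Ty) : Tm

/-- The typing judgement: `HasType n Γ t A` says that `t` has type `A` in the context `Γ` of term
variables (innermost first), the type variables in scope being `fvar 0, …, fvar (n - 1)`. -/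
inductive HasType : ℕ → List Ty → Tm → Ty → Prop
  | var {n Γ x A} : Γ[x]? = some A → HasType n Γ (.var x) A
  | lam {n Γ A t B} : A.WF n → HasType n (A :: Γ) t B → HasType n Γ (.lam A t) (.arr A B)
  | app {n Γ t u A B} :
      HasType n Γ t (.arr A B) → HasType n Γ u A → HasType n Γ (.app t u) B
  | tlam {n Γ t A} : (Ty.all A).WF n → HasType (n + 1) Γ t (A.inst (.fvar n)) →
      HasType n Γ (.tlam t) (.all A)
  | tapp {n Γ t A B} : HasType n Γ t (.all A) → B.WF n → HasType n Γ (.tapp t B) (A.inst B)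

/-- A term is `β`-normal if it has no subterm `(λ x. t) u` or `(Λ X. t) B`. -/
def BetaNormal : Tm → Prop
  | .var _ => True
  | .lam _ t => BetaNormal t
  | .app t u => (∀ A s, t ≠ .lam A s) ∧ BetaNormal t ∧ BetaNormal u
  | .tlam t => BetaNormal t
  | .tapp t _ => (∀ s, t ≠ .tlam s) ∧ BetaNormal t

/-- The type of `t` is a type variable. -/
def AtomicType (n : ℕ) (Γ : List Ty) (t : Tm) : Prop :=
  ∀ A, HasType n Γ t A → ∃ x, A = .fvar x

/-- `EtaExpanded n Γ false t`: the term `t` is `η`-expanded, that is, each of its subterms of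
function type or of quantified type is an abstraction or is applied to an argument. In
`EtaExpanded n Γ true t`, the term `t` itself is already known to be applied to an argument. -/
def EtaExpanded : ℕ → List Ty → Bool → Tm → Prop
  | n, Γ, applied, .var x => applied = false → AtomicType n Γ (.var x)
  | n, Γ, _, .lam A t => EtaExpanded n (A :: Γ) false t
  | n, Γ, applied, .app t u =>
      (applied = false → AtomicType n Γ (.app t u)) ∧
        EtaExpanded n Γ true t ∧ EtaExpanded n Γ false u
  | n, Γ, _, .tlam t => EtaExpanded (n + 1) Γ false t
  | n, Γ, applied, .tapp t B =>
      (applied = false → AtomicType n Γ (.tapp t B)) ∧ EtaExpanded n Γ true t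

/-- The `η`-expanded `β`-normal (closed) terms of the closed type `T`. -/
def etaLongNormalTerms (T : Ty) : Set Tm :=
  {t | HasType 0 [] t T ∧ BetaNormal t ∧ EtaExpanded 0 [] false t}

/-! ## The hypergame transition system and the black box game -/

/-- A label `⟨i, V₁ … Vₖ⟩`: a branch choice `i` and imports `V₁, …, Vₖ`. -/
structure Label : Type where
  branch : ℕ
  imports : List Ty
  deriving DecidableEq

/-- The states: types, and an additional initial state. -/
inductive State : Type
  | star : State
  | ty (S : Ty) : State

/-- The transition system of the type `T`. The transition `⟨1, V₁ … Vₖ⟩` leads from the initial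
state to `T · V₁ … Vₖ` if this is resolved; the transition `⟨i, V₁ … Vₖ⟩` leads from
`T₁ → … → Tₙ → X` to `Tᵢ · V₁ … Vₖ` if `1 ≤ i ≤ n` and this is resolved. -/
noncomputable def hyper (T : Ty) : Backtracking.TransitionSystem State Label where
  init := .star
  step
    | .star, ⟨i, Vs⟩ => if i = 1 then (T.resolve Vs).map .ty else none
    | .ty S, ⟨i, Vs⟩ =>
        if 1 ≤ i then (S.branches[i - 1]?).bind (fun A => (A.resolve Vs).map .ty) else none

/-- Dialogues over the labels. -/
abbrev Dialogue : Type := List (ℕ × Label)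

/-- The types imported by the first player `O` (who makes the moves in odd position), in order. -/
def oImports : Dialogue → List Ty
  | [] => []
  | [m] => m.2.imports
  | m :: _ :: d => m.2.imports ++ oImports d

/-- The list of type variables number `n, n + 1, …, n + k - 1`. -/
def blackBoxes (n k : ℕ) : List Ty := (List.range k).map (fun j => .fvar (n + j))

/-- `O` imports black boxes in `d`: every import of `O` is a fresh variable. Since the names of
bound variables carry no meaning, the fresh variables are always taken to be the next ones in the
fixed enumeration of the variables that `O` has not imported yet. -/
def OImportsBlackBoxes (d : Dialogue) : Prop :=
  ∀ i a l, d[i]? = some (a, l) → Odd (i + 1) →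
    l.imports = blackBoxes (oImports (d.take i)).length l.imports.length

/-- `P` respects black boxes in `d`: the free variables of each import of `P` are among the black
boxes that `O` has imported before. -/
def PRespectsBlackBoxes (d : Dialogue) : Prop :=
  ∀ i a l, d[i]? = some (a, l) → Even (i + 1) →
    ∀ V ∈ l.imports, ∀ x ∈ V.fv, Ty.fvar x ∈ oImports (d.take i)

/-- The black box game of `T`. -/
def blackBoxGame (T : Ty) : Set Dialogue :=
  {d | d ∈ Backtracking.pBacktrack (hyper T).game ∧ OImportsBlackBoxes d ∧ PRespectsBlackBoxes d}

/-- `HasColour T d j X`: the move of `d` in position `j` has colour `X`, that is, `X` is the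
rightmost variable of the target of the associated transition. -/
def HasColour (T : Ty) (d : Dialogue) (j X : ℕ) : Prop :=
  ∃ s S, Backtracking.ThreadTo d j s ∧ (hyper T).run s = some (.ty S) ∧ S.colour = some X

/-- The copycat condition for a dialogue: each move of `P` has the same colour as the move of `O`
immediately before it. -/
def CopycatDialogue (T : Ty) (d : Dialogue) : Prop :=
  ∀ j, Even (j + 1) → j + 1 ≤ d.length → ∃ X, HasColour T d j X ∧ HasColour T d (j + 1) X

/-- The finite live strategies on the black box game of `T` that satisfy the copycat condition. -/
def copycatStrategies (T : Ty) : Set (Set Dialogue) :=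
  {σ | Backtracking.IsStrategy (blackBoxGame T) σ ∧ Backtracking.IsLive (blackBoxGame T) σ ∧
    σ.Finite ∧ ∀ d ∈ σ, CopycatDialogue T d}

/-! ## The strategy of a term -/

namespace Tm

/-- The number of `λ`s in the maximal prefix of `λ`s and `Λ`s. -/
def lams : Tm → ℕ
  | lam _ t => t.lams + 1
  | tlam t => t.lams
  | _ => 0

/-- The number of `Λ`s in the maximal prefix of `λ`s and `Λ`s. -/
def tlams : Tm → ℕ
  | lam _ t => t.tlams
  | tlam t => t.tlams + 1
  | _ => 0

/-- What remains after the maximal prefix of `λ`s and `Λ`s. -/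
def body : Tm → Tm
  | lam _ t => t.body
  | tlam t => t.body
  | t => t

/-- The variable `x` in a term of the form `x a₁ … aₖ`, with terms or types `aᵢ`. -/
def headVar : Tm → Option ℕ
  | var x => some x
  | app t _ => t.headVar
  | tapp t _ => t.headVar
  | _ => none

/-- The terms among `a₁, …, aₖ` in `x a₁ … aₖ`. -/
def tmArgs : Tm → List Tm
  | app t u => t.tmArgs ++ [u]
  | tapp t _ => t.tmArgs
  | _ => []

/-- The types among `a₁, …, aₖ` in `x a₁ … aₖ`. -/
def tyArgs : Tm → List Ty
  | app t _ => t.tyArgs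
  | tapp t B => t.tyArgs ++ [B]
  | _ => []

/-- What the `m` `λ`s of a prefix entered by the move in position `q` stand for, innermost first:
the `b`-th of them, counted from the outside, stands for the branch `b` at position `q`. -/
def binders (q m : ℕ) : List (ℕ × ℕ) := (List.range m).reverse.map (fun b => (q, b + 1))

/-- `Plays n p ρ i t s`: suppose that `p` moves have been made, that `O` has imported `n` black
boxes and that the term variable `x` stands for the branch `b` at position `q` if `ρ[x] = (q, b)`.
Then `s` is a possible continuation if `O` enters the term `t` through branch `i`, and `P` answers
according to `t`. That is, `O` points to the previous move and imports one black box for each `Λ` in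
the prefix of `t`; `P` answers with the pointer and the branch for which the head variable of the
body of `t` stands, and imports the type arguments of the head variable; next, `O` may enter the
`j`-th term argument of the head variable through branch `j`. -/
inductive Plays : ℕ → ℕ → List (ℕ × ℕ) → ℕ → Tm → Dialogue → Prop
  | nil {n p ρ i t} : Plays n p ρ i t []
  | enter {n p ρ i t} : Plays n p ρ i t [(p, ⟨i, blackBoxes n t.tlams⟩)]
  | answer {n p ρ i t x q b} :
      t.body.headVar = some x → (binders (p + 1) t.lams ++ ρ)[x]? = some (q, b) →
      Plays n p ρ i t [(p, ⟨i, blackBoxes n t.tlams⟩), (q, ⟨b, t.body.tyArgs⟩)]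
  | next {n p ρ i t x q b j u s} :
      t.body.headVar = some x → (binders (p + 1) t.lams ++ ρ)[x]? = some (q, b) →
      t.body.tmArgs[j]? = some u →
      Plays (n + t.tlams) (p + 2) (binders (p + 1) t.lams ++ ρ) (j + 1) u s →
      Plays n p ρ i t ((p, ⟨i, blackBoxes n t.tlams⟩) :: (q, ⟨b, t.body.tyArgs⟩) :: s)

/-- The strategy of a closed term: the dialogues in which `P` plays according to the term. -/
def strategy (t : Tm) : Set Dialogue := {s | Plays 0 0 [] 1 t s}

end Tm

end SystemF

/-! A term and a copycat strategy are two descriptions of one tree. An `η`-long normal term of type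
`A` begins with a prefix of abstractions that `A` dictates: the `Λ`s import fresh variables until
`A` is resolved to `S = T₁ → … → Tₙ → X`, and the `λ`s bind variables of types `T₁, …, Tₙ`. The body
has the atomic type `X`. It is a variable of some type `A'` in scope, applied to types that resolve
`A'` to some `S'` and to one `η`-long term for each branch of `S'`; its type is the colour of `S'`.
So the typing of the body amounts to equality of the colours of `S` and `S'`, which is the copycat
condition. `EtaLong.decompose` takes a term apart in this way and `exists_etaLong` puts it together.

In the game, a move of `O` that chooses the branch of type `A` leads to `S`, and the answer of `P`
leads to `S'`. The variables in scope are the branches of the states that `O` has reached so far, so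
a pointer with a branch choice names a variable. Levels for bound type variables agree with the
canonical names of the black boxes. `Config` records this dictionary, and `Config.round` shows that
it survives a move of `O` with a copycat answer.

Inductions along plays then show that the plays of a term form a live copycat strategy; the strategy
is finite because arguments are smaller than the term. Injectivity (`EtaLong.eq_of_plays_iff`) is an
induction on the term: the first answer reveals the head variable and its type arguments, and the
later moves reveal the term arguments. For surjectivity (`exists_etaLong_plays`) the term is read
off from the answers of the strategy; finiteness bounds the length of its dialogues, so this
recursion ends. -/

namespace SystemF

open Backtracking

/-! ### Types: importation and resolution. -/

namespace Ty

theorem LC.mono {A : Ty} {k m : ℕ} (h : A.LC k) (hkm : k ≤ m) : A.LC m := by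
  induction A generalizing k m with
  | fvar x => trivial
  | bvar i => exact lt_of_lt_of_le h hkm
  | arr A B ihA ihB => exact ⟨ihA h.1 hkm, ihB h.2 hkm⟩
  | all A ih => exact ih (k := k + 1) (m := m + 1) h (by omega)

theorem LC.instAt {A V : Ty} {k : ℕ} (h : A.LC (k + 1)) (hV : V.LC 0) : (A.instAt k V).LC k := by
  induction A generalizing k with
  | fvar x => trivial
  | bvar i =>
    have hi : i < k + 1 := h
    unfold Ty.instAt
    split_ifs with hk
    · exact hV.mono (Nat.zero_le _)
    · show i < k
      omega
  | arr A B ihA ihB => exact ⟨ihA h.1, ihB h.2⟩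
  | all A ih => exact ih (k := k + 1) h

theorem mem_fv_instAt {A V : Ty} {k x : ℕ} (h : x ∈ (A.instAt k V).fv) : x ∈ A.fv ∨ x ∈ V.fv := by
  induction A generalizing k with
  | fvar y => exact Or.inl h
  | bvar i =>
    unfold Ty.instAt at h
    split_ifs at h with hk
    · exact Or.inr h
    · simp [Ty.fv] at h
  | arr A B ihA ihB =>
    simp only [Ty.instAt, Ty.fv, Finset.mem_union] at h ⊢
    rcases h with h | h
    · rcases ihA h with h | h <;> tauto
    · rcases ihB h with h | h <;> tauto
  | all A ih => exact ih (k := k + 1) h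

theorem WF.inst {A V : Ty} {n : ℕ} (h : (Ty.all A).WF n) (hV : V.WF n) : (A.inst V).WF n :=
  ⟨LC.instAt h.1 hV.1, fun x hx => (mem_fv_instAt hx).elim (h.2 x) (hV.2 x)⟩

theorem WF.mono {A : Ty} {n m : ℕ} (h : A.WF n) (hnm : n ≤ m) : A.WF m :=
  ⟨h.1, fun x hx => (h.2 x hx).trans_le hnm⟩

theorem WF.fvar {n m : ℕ} (h : n < m) : (Ty.fvar n).WF m :=
  ⟨trivial, fun x hx => by simp only [Ty.fv, Finset.mem_singleton] at hx; omega⟩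

theorem WF.left {A B : Ty} {n : ℕ} (h : (Ty.arr A B).WF n) : A.WF n :=
  ⟨h.1.1, fun x hx => h.2 x (Finset.mem_union_left _ hx)⟩

theorem WF.right {A B : Ty} {n : ℕ} (h : (Ty.arr A B).WF n) : B.WF n :=
  ⟨h.1.2, fun x hx => h.2 x (Finset.mem_union_right _ hx)⟩

theorem WF.arr {A B : Ty} {n : ℕ} (hA : A.WF n) (hB : B.WF n) : (Ty.arr A B).WF n :=
  ⟨⟨hA.1, hB.1⟩, fun x hx => (Finset.mem_union.1 hx).elim (hA.2 x) (hB.2 x)⟩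

theorem WF.imp {A V B : Ty} {n : ℕ} (h : A.WF n) (hV : V.WF n) (hB : A.imp V = some B) :
    B.WF n := by
  induction A generalizing B with
  | fvar x => simp [Ty.imp] at hB
  | bvar x => simp [Ty.imp] at hB
  | arr A C _ ih =>
    simp only [Ty.imp, Option.map_eq_some_iff] at hB
    obtain ⟨D, hD, rfl⟩ := hB
    exact h.left.arr (ih h.right hD)
  | all A _ =>
    simp only [Ty.imp, Option.some.injEq] at hB
    exact hB ▸ h.inst hV

@[simp] theorem impAll_nil (A : Ty) : A.impAll [] = some A := rfl

theorem impAll_cons (A V : Ty) (Vs : List Ty) :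
    A.impAll (V :: Vs) = (A.imp V).bind (fun B => B.impAll Vs) := rfl

theorem impAll_append (A : Ty) (Vs Ws : List Ty) :
    A.impAll (Vs ++ Ws) = (A.impAll Vs).bind (fun B => B.impAll Ws) := by
  simp only [Ty.impAll, List.foldlM_append]; rfl

theorem impAll_all (A V : Ty) (Vs : List Ty) : (all A).impAll (V :: Vs) = (A.inst V).impAll Vs := rfl

theorem impAll_arr (A B : Ty) (Vs : List Ty) :
    (arr A B).impAll Vs = (B.impAll Vs).map (arr A) := by
  induction Vs generalizing B with
  | nil => rfl
  | cons V Vs ih =>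
    rw [impAll_cons, impAll_cons, Ty.imp]
    cases B.imp V with
    | none => rfl
    | some C => exact ih C

theorem WF.impAll {A B : Ty} {Vs : List Ty} {n : ℕ} (h : A.WF n) (hV : ∀ V ∈ Vs, V.WF n)
    (hB : A.impAll Vs = some B) : B.WF n := by
  induction Vs generalizing A with
  | nil => simp only [impAll_nil, Option.some.injEq] at hB; exact hB ▸ h
  | cons V Vs ih =>
    rw [impAll_cons, Option.bind_eq_some_iff] at hB
    obtain ⟨C, hC, hB⟩ := hB
    exact ih (h.imp (hV V (by simp)) hC) (fun W hW => hV W (by simp [hW])) hB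

theorem WF.branches {A B : Ty} {n : ℕ} (h : A.WF n) (hB : B ∈ A.branches) : B.WF n := by
  induction A with
  | fvar x => simp [Ty.branches] at hB
  | bvar x => simp [Ty.branches] at hB
  | all A _ => simp [Ty.branches] at hB
  | arr A C _ ih =>
    rcases List.mem_cons.1 hB with rfl | hB
    · exact h.left
    · exact ih h.right hB

theorem Resolved.imp_eq_none {A : Ty} (h : A.Resolved) (V : Ty) : A.imp V = none := by
  obtain ⟨x, h⟩ := h
  induction A with
  | fvar x => rfl
  | bvar x => rfl
  | all A _ => simp [Ty.colour] at h
  | arr A C _ ih => simp [Ty.imp, ih h]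

theorem Resolved.eq_nil {A B : Ty} {Vs : List Ty} (h : A.Resolved) (hB : A.impAll Vs = some B) :
    Vs = [] := by
  cases Vs with
  | nil => rfl
  | cons V Vs => simp [impAll_cons, h.imp_eq_none] at hB

theorem resolve_eq_some {A S : Ty} {Vs : List Ty} :
    A.resolve Vs = some S ↔ (∀ V ∈ Vs, V.LC 0) ∧ A.impAll Vs = some S ∧ S.Resolved := by
  unfold Ty.resolve
  split_ifs with h
  · simp only [Option.filter_eq_some_iff, decide_eq_true_eq]
    tauto
  · simp [h]

/-- The number of arrows and quantifiers. -/
def size : Ty → ℕ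
  | fvar _ => 0
  | bvar _ => 0
  | arr A B => A.size + B.size + 1
  | all A => A.size + 1

/-- This makes the size a measure for the induction in `exists_etaLong_of_body`, where quantifiers
are only instantiated by variables. An arbitrary import could make the type larger. -/
theorem size_instAt_fvar (A : Ty) (k n : ℕ) : (A.instAt k (fvar n)).size = A.size := by
  induction A generalizing k with
  | fvar x => rfl
  | bvar i => unfold Ty.instAt; split_ifs <;> rfl
  | arr A B ihA ihB => simp [Ty.instAt, size, ihA, ihB]
  | all A ih => simp [Ty.instAt, size, ih]

end Ty

/-! ### Black boxes. -/

@[simp] theorem blackBoxes_zero (n : ℕ) : blackBoxes n 0 = [] := rfl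

@[simp] theorem length_blackBoxes (n k : ℕ) : (blackBoxes n k).length = k := by
  simp [blackBoxes]

theorem blackBoxes_add (n k m : ℕ) :
    blackBoxes n (k + m) = blackBoxes n k ++ blackBoxes (n + k) m := by
  simp [blackBoxes, List.range_add, Function.comp_def, Nat.add_assoc]

theorem blackBoxes_succ (n k : ℕ) : blackBoxes n (k + 1) = .fvar n :: blackBoxes (n + 1) k := by
  rw [Nat.add_comm, blackBoxes_add]; rfl

theorem mem_blackBoxes {V : Ty} {n k : ℕ} : V ∈ blackBoxes n k ↔ ∃ j < k, V = .fvar (n + j) := by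
  simp [blackBoxes, eq_comm]

theorem fvar_mem_blackBoxes_zero {x n : ℕ} : Ty.fvar x ∈ blackBoxes 0 n ↔ x < n := by
  simp [mem_blackBoxes]

theorem LC_of_mem_blackBoxes {V : Ty} {n k : ℕ} (h : V ∈ blackBoxes n k) : V.LC 0 := by
  obtain ⟨j, _, rfl⟩ := mem_blackBoxes.1 h
  trivial

theorem WF_of_mem_blackBoxes {V : Ty} {n k : ℕ} (h : V ∈ blackBoxes n k) : V.WF (n + k) := by
  obtain ⟨j, hj, rfl⟩ := mem_blackBoxes.1 h
  exact Ty.WF.fvar (by omega)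

/-- The longer list extends the shorter one, after which no quantifier is available any more. So the
type that is entered dictates how many black boxes `O` imports. -/
theorem resolve_blackBoxes_unique {A S S' : Ty} {n k k' : ℕ}
    (h : A.resolve (blackBoxes n k) = some S) (h' : A.resolve (blackBoxes n k') = some S') :
    k = k' := by
  wlog hk : k ≤ k' generalizing k k' S S'
  · exact (this h' h (by omega)).symm
  obtain ⟨m, rfl⟩ := Nat.exists_eq_add_of_le hk
  rw [Ty.resolve_eq_some] at h h'
  have h2 := h'.2.1
  rw [blackBoxes_add, Ty.impAll_append, h.2.1] at h2
  have := congrArg List.length (h.2.2.eq_nil h2)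
  simp at this
  omega

/-! ### Terms -/

/-- `AtomicType` quantifies over all types of a term; by uniqueness one derivation suffices to
establish it. -/
theorem HasType.unique {n : ℕ} {Γ : List Ty} {t : Tm} {A B : Ty} (hA : HasType n Γ t A)
    (hB : HasType n Γ t B) : A = B := by
  induction hA generalizing B with
  | var h => cases hB with | var h' => exact Option.some.inj (h.symm.trans h')
  | lam _ _ ih => cases hB with | lam _ h' => rw [ih h']
  | app _ _ ih _ =>
    cases hB with | app h' _ => exact (Ty.arr.inj (ih h')).2
  | @tlam n Γ t A hA _ ih =>
    cases hB with
    | @tlam _ _ _ B hB h' =>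
      have := ih h'
      rw [Ty.all.injEq]
      -- Replacing a bound index by the variable `n` loses no information, because `n` occurs in
      -- neither body.
      have key : ∀ (A B : Ty) (k : ℕ), (∀ x ∈ A.fv, x < n) → (∀ x ∈ B.fv, x < n) →
          A.instAt k (.fvar n) = B.instAt k (.fvar n) → A = B := by
        intro A
        induction A with
        | fvar x =>
          intro B k hA hB h
          cases B with
          | bvar i =>
            simp only [Ty.instAt] at h
            split_ifs at h
            have := hA x (by simp [Ty.fv])
            injection h
            omega
          | _ => simp_all [Ty.instAt]
        | bvar i =>
          intro B k hA hB h
          cases B with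
          | fvar x =>
            simp only [Ty.instAt] at h
            split_ifs at h
            have := hB x (by simp [Ty.fv])
            injection h
            omega
          | bvar j =>
            simp only [Ty.instAt] at h
            split_ifs at h with h1 h2 h2
            · rw [h1, h2]
            · exact h
          | _ => simp only [Ty.instAt] at h; split_ifs at h
        | arr A1 A2 ih1 ih2 =>
          intro B k hA hB h
          cases B with
          | arr B1 B2 =>
            simp only [Ty.instAt, Ty.arr.injEq] at h
            simp only [Ty.fv, Finset.mem_union] at hA hB
            rw [ih1 B1 k (fun x hx => hA x (.inl hx)) (fun x hx => hB x (.inl hx)) h.1,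
              ih2 B2 k (fun x hx => hA x (.inr hx)) (fun x hx => hB x (.inr hx)) h.2]
          | bvar j => simp only [Ty.instAt] at h; split_ifs at h
          | _ => simp [Ty.instAt] at h
        | all A ih =>
          intro B k hA hB h
          cases B with
          | all B =>
            simp only [Ty.instAt, Ty.all.injEq] at h
            rw [ih B (k + 1) hA hB h]
          | bvar j => simp only [Ty.instAt] at h; split_ifs at h
          | _ => simp [Ty.instAt] at h
      exact key A B 0 hA.2 hB.2 this
  | tapp _ _ ih =>
    cases hB with | tapp h' _ => rw [Ty.all.inj (ih h')]

theorem HasType.atomicType {n : ℕ} {Γ : List Ty} {t : Tm} {x : ℕ} (h : HasType n Γ t (.fvar x)) :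
    AtomicType n Γ t := fun _ hA => ⟨x, hA.unique h⟩

/-- The `η`-expanded `β`-normal terms of type `A` in a context. -/
structure EtaLong (n : ℕ) (Γ : List Ty) (t : Tm) (A : Ty) : Prop where
  hasType : HasType n Γ t A
  betaNormal : BetaNormal t
  etaExpanded : EtaExpanded n Γ false t

/-! ### Spines: head variables with their arguments. -/

namespace Tm

theorem prefix_of_headVar {t : Tm} (h : t.headVar.isSome) :
    t.tlams = 0 ∧ t.lams = 0 ∧ t.body = t := by
  cases t <;> simp_all [tlams, lams, body, headVar]

theorem sizeOf_body_le (t : Tm) : sizeOf t.body ≤ sizeOf t := by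
  induction t with
  | lam A t ih => simp [body]; omega
  | tlam t ih => simp [body]; omega
  | _ => simp [body]

theorem sizeOf_lt_of_mem_tmArgs {t u : Tm} (h : u ∈ t.tmArgs) : sizeOf u < sizeOf t := by
  induction t with
  | app t v ih _ =>
    simp only [tmArgs, List.mem_append, List.mem_singleton] at h
    rcases h with h | rfl
    · have := ih h
      simp; omega
    · simp
  | tapp t B ih =>
    have := ih h
    simp; omega
  | _ => simp [tmArgs] at h

theorem sizeOf_lt_of_mem_tmArgs_body {t u : Tm} (h : u ∈ t.body.tmArgs) : sizeOf u < sizeOf t :=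
  (sizeOf_lt_of_mem_tmArgs h).trans_le (sizeOf_body_le t)

/-- `Spine P h A Vs us t B`: the term `t` of type `B` results when the term `h` of type `A` is
applied to the types `Vs` and the terms `us`, interleaved as `A` demands, and `P u C` holds for
each of the terms `u` and the type `C` that is demanded. -/
inductive Spine (P : Tm → Ty → Prop) : Tm → Ty → List Ty → List Tm → Tm → Ty → Prop
  | nil {h A} : Spine P h A [] [] h A
  | app {h A B Vs u us t C} : P u A → Spine P (.app h u) B Vs us t C →
      Spine P h (.arr A B) Vs (u :: us) t C
  | tapp {h A V Vs us t C} :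
      Spine P (.tapp h V) (A.inst V) Vs us t C → Spine P h (.all A) (V :: Vs) us t C

variable {P : Tm → Ty → Prop}

/-- A spine consumes its arguments from the head outwards, whereas a typing derivation exposes the
last argument first. This lemma and the next reconcile the two orders. -/
theorem Spine.append_app {h A Vs us t B C} {u : Tm} (hs : Spine P h A Vs us t (.arr B C))
    (hu : P u B) : Spine P h A Vs (us ++ [u]) (.app t u) C := by
  generalize hD : Ty.arr B C = D at hs
  induction hs with
  | nil => subst hD; exact .app hu .nil
  | app hv _ ih => exact .app hv (ih hD)
  | tapp _ ih => exact .tapp (ih hD)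

theorem Spine.append_tapp {h A Vs us t B} (V : Ty) (hs : Spine P h A Vs us t (.all B)) :
    Spine P h A (Vs ++ [V]) us (.tapp t V) (B.inst V) := by
  generalize hD : Ty.all B = D at hs
  induction hs with
  | nil => subst hD; exact .tapp .nil
  | app hv _ ih => exact .app hv (ih hD)
  | tapp _ ih => exact .tapp (ih hD)

theorem Spine.unique {h A Vs us t t' B B'} (hs : Spine P h A Vs us t B)
    (hs' : Spine P h A Vs us t' B') : t = t' := by
  induction hs with
  | nil => cases hs'; rfl
  | app _ _ ih => cases hs' with | app _ hs' => exact ih hs'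
  | tapp _ ih => cases hs' with | tapp hs' => exact ih hs'

/-- Importation passes under arrows, so the type arguments have the same effect without the term
arguments in between. The arrows that the term arguments consume reappear as branches of the
resolved type. -/
theorem Spine.impAll {h A Vs us t X} (hs : Spine P h A Vs us t (.fvar X)) :
    ∃ S, A.impAll Vs = some S ∧ S.colour = some X ∧ S.branches.length = us.length ∧
      ∀ (j : ℕ) u, us[j]? = some u → ∃ C, S.branches[j]? = some C ∧ P u C := by
  generalize hD : Ty.fvar X = D at hs
  induction hs with
  | nil => subst hD; exact ⟨_, rfl, rfl, rfl, by simp⟩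
  | @app h A B Vs u us t C hu _ ih =>
    obtain ⟨S, h1, h2, h3, h4⟩ := ih hD
    refine ⟨.arr A S, by simp [Ty.impAll_arr, h1], h2, by simp [Ty.branches, h3], ?_⟩
    rintro (_ | j) v hv
    · simp only [List.getElem?_cons_zero, Option.some.injEq] at hv
      exact ⟨A, rfl, hv ▸ hu⟩
    · exact h4 j v hv
  | tapp _ ih => exact ih hD

/-- The type `A` dictates how types and terms interleave, so the two separate lists determine the
application. -/
theorem Spine.exists_of_impAll {h : Tm} {A S : Ty} {Vs : List Ty} {us : List Tm} {X : ℕ}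
    (hS : A.impAll Vs = some S) (hX : S.colour = some X) (hlen : us.length = S.branches.length)
    (hP : ∀ (j : ℕ) u C, us[j]? = some u → S.branches[j]? = some C → P u C) :
    ∃ t, Spine P h A Vs us t (.fvar X) := by
  -- The induction is on the number of arguments, since `A.inst V` need not be smaller than `A.all`.
  generalize hm : Vs.length + us.length = m
  induction m generalizing h A S Vs us with
  | zero =>
    obtain rfl : Vs = [] := List.eq_nil_of_length_eq_zero (by omega)
    obtain rfl : us = [] := List.eq_nil_of_length_eq_zero (by omega)
    simp only [Ty.impAll_nil, Option.some.injEq] at hS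
    subst hS
    cases A with
    | fvar x =>
      simp only [Ty.colour, Option.some.injEq] at hX
      exact ⟨h, hX ▸ .nil⟩
    | arr A B => simp [Ty.branches] at hlen
    | bvar i => simp [Ty.colour] at hX
    | all A => simp [Ty.colour] at hX
  | succ m ih =>
    cases A with
    | fvar x =>
      obtain rfl := Ty.Resolved.eq_nil ⟨x, rfl⟩ hS
      simp only [Ty.impAll_nil, Option.some.injEq] at hS
      subst hS
      simp only [Ty.branches, List.length_nil] at hlen hm
      omega
    | bvar x =>
      cases Vs with
      | nil =>
        simp only [Ty.impAll_nil, Option.some.injEq] at hS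
        subst hS
        simp [Ty.colour] at hX
      | cons => simp [Ty.impAll_cons, Ty.imp] at hS
    | all A =>
      cases Vs with
      | nil =>
        simp only [Ty.impAll_nil, Option.some.injEq] at hS
        subst hS
        simp [Ty.colour] at hX
      | cons V Vs =>
        obtain ⟨t, ht⟩ := ih (h := .tapp h V) (A := A.inst V) hS hX hlen hP
          (by simp at hm; omega)
        exact ⟨t, .tapp ht⟩
    | arr A B =>
      rw [Ty.impAll_arr, Option.map_eq_some_iff] at hS
      obtain ⟨S', hS', rfl⟩ := hS
      cases us with
      | nil => simp [Ty.branches] at hlen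
      | cons u us =>
        obtain ⟨t, ht⟩ := ih (h := .app h u) (A := B) (us := us) hS' hX
          (by simpa [Ty.branches] using hlen)
          (fun j v C hv hC => hP (j + 1) v C hv hC) (by simp at hm; omega)
        exact ⟨t, .app (hP 0 u A rfl rfl) ht⟩

theorem Spine.headVar_eq {h A Vs us t C} (hs : Spine P h A Vs us t C) :
    t.headVar = h.headVar ∧ t.tyArgs = h.tyArgs ++ Vs ∧ t.tmArgs = h.tmArgs ++ us := by
  induction hs with
  | nil => simp
  | app _ _ ih => simpa [headVar, tyArgs, tmArgs] using ih
  | tapp _ ih => simpa [headVar, tyArgs, tmArgs] using ih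

theorem EtaExpanded_of_atomic {n : ℕ} {Γ : List Ty} {t : Tm} (h : EtaExpanded n Γ true t)
    (hx : t.headVar.isSome) (ht : AtomicType n Γ t) : EtaExpanded n Γ false t := by
  cases t with
  | var x => exact fun _ => ht
  | app t u => exact ⟨fun _ => ht, h.2⟩
  | tapp t B => exact ⟨fun _ => ht, h.2⟩
  | lam A t => simp [headVar] at hx
  | tlam t => simp [headVar] at hx

/-- The head grows along the spine. Proper initial parts are applied to an argument, so atomicity is
needed only at the end; no redex arises, as a term with a head variable is not an abstraction. -/
theorem Spine.etaLong {n : ℕ} {Γ : List Ty} {h A Vs us t X}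
    (hs : Spine (EtaLong n Γ) h A Vs us t (.fvar X)) (hV : ∀ V ∈ Vs, V.WF n)
    (hh : HasType n Γ h A) (hb : BetaNormal h) (he : EtaExpanded n Γ true h)
    (hx : h.headVar.isSome) : EtaLong n Γ t (.fvar X) := by
  generalize hD : Ty.fvar X = D at hs
  induction hs with
  | nil => subst hD; exact ⟨hh, hb, EtaExpanded_of_atomic he hx hh.atomicType⟩
  | @app h A B Vs u us t C hu _ ih =>
    refine ih hV (hh.app hu.hasType) ⟨?_, hb, hu.betaNormal⟩ ⟨by simp, he, hu.etaExpanded⟩ hx hD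
    rintro A s rfl
    simp [headVar] at hx
  | @tapp h A V Vs us t C _ ih =>
    refine ih (fun W hW => hV W (by simp [hW])) (hh.tapp (hV V (by simp))) ⟨?_, hb⟩ ⟨by simp, he⟩ hx
      hD
    rintro s rfl
    simp [headVar] at hx

end Tm

/-- The function part of an application is not an abstraction: one of the matching kind would form a
redex, one of the other kind would be ill-typed. -/
theorem HasType.headVar_isSome {n : ℕ} {Γ : List Ty} {t : Tm} {A : Ty} (h : HasType n Γ t A)
    (hb : BetaNormal t) (hl : ∀ B s, t ≠ .lam B s) (htl : ∀ s, t ≠ .tlam s) :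
    t.headVar.isSome := by
  induction h with
  | var => rfl
  | lam => exact absurd rfl (hl _ _)
  | tlam => exact absurd rfl (htl _)
  | app h1 h2 ih1 ih2 =>
    refine ih1 hb.2.1 hb.1 ?_
    rintro s rfl
    cases h1
  | tapp h1 h2 ih =>
    refine ih hb.2 ?_ hb.1
    rintro B s rfl
    cases h1

/-- A neutral `β`-normal `η`-expanded term is a spine that starts with its head variable. -/
theorem HasType.spine {n : ℕ} {Γ : List Ty} {t : Tm} {B : Ty} {x : ℕ} {applied : Bool}
    (h : HasType n Γ t B) (hb : BetaNormal t) (he : EtaExpanded n Γ applied t)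
    (hx : t.headVar = some x) :
    ∃ A, Γ[x]? = some A ∧ Tm.Spine (EtaLong n Γ) (.var x) A t.tyArgs t.tmArgs t B ∧
      ∀ V ∈ t.tyArgs, V.WF n := by
  induction h generalizing applied with
  | var h =>
    simp only [Tm.headVar, Option.some.injEq] at hx
    subst hx
    exact ⟨_, h, .nil, by simp [Tm.tyArgs]⟩
  | lam => simp [Tm.headVar] at hx
  | tlam => simp [Tm.headVar] at hx
  | app h1 h2 ih1 ih2 =>
    obtain ⟨A, hA, hs, hV⟩ := ih1 hb.2.1 he.2.1 hx
    exact ⟨A, hA, hs.append_app ⟨h2, hb.2.2, he.2.2⟩, hV⟩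
  | tapp h1 h2 ih =>
    obtain ⟨A, hA, hs, hV⟩ := ih hb.2 he.2 hx
    refine ⟨A, hA, hs.append_tapp _, ?_⟩
    simp only [Tm.tyArgs, List.mem_append, List.mem_singleton]
    rintro V (hV' | rfl)
    exacts [hV V hV', h2]

/-- A `β`-normal `η`-expanded term that is not an abstraction is neutral, of atomic type. -/
theorem EtaLong.atomic {n : ℕ} {Γ : List Ty} {t : Tm} {A : Ty} (h : EtaLong n Γ t A)
    (hl : ∀ B s, t ≠ .lam B s) (htl : ∀ s, t ≠ .tlam s) :
    (∃ X, A = .fvar X) ∧ t.headVar.isSome := by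
  refine ⟨?_, h.hasType.headVar_isSome h.betaNormal hl htl⟩
  have he := h.etaExpanded
  cases t with
  | var x => exact he rfl A h.hasType
  | app t u => exact he.1 rfl A h.hasType
  | tapp t B => exact he.1 rfl A h.hasType
  | lam B s => exact absurd rfl (hl _ _)
  | tlam s => exact absurd rfl (htl _)

/-- The prefix of abstractions of an `η`-long term resolves its type. -/
theorem EtaLong.body {n : ℕ} {Γ : List Ty} {t : Tm} {A : Ty} (h : EtaLong n Γ t A) :
    ∃ S X, A.resolve (blackBoxes n t.tlams) = some S ∧ S.branches.length = t.lams ∧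
      S.colour = some X ∧ t.body.headVar.isSome ∧
      EtaLong (n + t.tlams) (S.branches.reverse ++ Γ) t.body (.fvar X) := by
  simp only [Ty.resolve_eq_some]
  obtain ⟨h1, h2, h3⟩ := h
  induction t generalizing n Γ A with
  | lam B t ih =>
    cases h1 with
    | @lam _ _ _ _ C hB h1 =>
      obtain ⟨S, X, ⟨r1, r2, r3⟩, hl, hc, hh, hg⟩ := ih h1 h2 h3
      refine ⟨.arr B S, X, ⟨r1, ?_, ⟨X, hc⟩⟩, by simp [Ty.branches, hl, Tm.lams], hc, hh, ?_⟩
      · simp only [Ty.impAll_arr, Tm.tlams, r2, Option.map_some]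
      · simpa [Ty.branches, Tm.tlams, Tm.body] using hg
  | tlam t ih =>
    cases h1 with
    | @tlam _ _ _ B hB h1 =>
      obtain ⟨S, X, ⟨r1, r2, r3⟩, hl, hc, hh, hg⟩ := ih h1 h2 h3
      refine ⟨S, X, ⟨fun V => LC_of_mem_blackBoxes, ?_, r3⟩, hl, hc, hh, ?_⟩
      · simp only [Tm.tlams, blackBoxes_succ, Ty.impAll_all]
        exact r2
      · simp only [Tm.tlams, Tm.body]
        rwa [show n + (t.tlams + 1) = n + 1 + t.tlams by omega]
  | _ =>
    have hg := EtaLong.mk h1 h2 h3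
    obtain ⟨⟨X, rfl⟩, hh⟩ := hg.atomic (by simp) (by simp)
    exact ⟨.fvar X, X, ⟨by simp [Tm.tlams], rfl, X, rfl⟩, rfl, rfl, hh, hg⟩

/-- What an `η`-long term looks like. -/
theorem EtaLong.decompose {n : ℕ} {Γ : List Ty} {t : Tm} {A : Ty} (h : EtaLong n Γ t A) :
    ∃ S X x A' S', A.resolve (blackBoxes n t.tlams) = some S ∧ S.branches.length = t.lams ∧
      S.colour = some X ∧ t.body.headVar = some x ∧ (S.branches.reverse ++ Γ)[x]? = some A' ∧
      (∀ V ∈ t.body.tyArgs, V.WF (n + t.tlams)) ∧ A'.resolve t.body.tyArgs = some S' ∧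
      S'.colour = some X ∧ S'.branches.length = t.body.tmArgs.length ∧
      ∀ (j : ℕ) u, t.body.tmArgs[j]? = some u → ∃ C, S'.branches[j]? = some C ∧
        EtaLong (n + t.tlams) (S.branches.reverse ++ Γ) u C := by
  obtain ⟨S, X, hS, hl, hX, hh, hb⟩ := h.body
  obtain ⟨x, hx⟩ := Option.isSome_iff_exists.1 hh
  obtain ⟨A', hA', hs, hV⟩ := hb.hasType.spine hb.betaNormal hb.etaExpanded hx
  obtain ⟨S', h1, h2, h3, h4⟩ := hs.impAll
  exact ⟨S, X, x, A', S', hS, hl, hX, hx, hA', hV,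
    Ty.resolve_eq_some.2 ⟨fun V hV' => (hV V hV').1, h1, X, h2⟩, h2, h3, h4⟩

/-- An `η`-long term is determined by its type and its body. -/
theorem EtaLong.eq_of_body_eq {n : ℕ} {Γ : List Ty} {t t' : Tm} {A : Ty} (h : EtaLong n Γ t A)
    (h' : EtaLong n Γ t' A) (hb : t.body = t'.body) : t = t' := by
  obtain ⟨h1, h2, h3⟩ := h
  obtain ⟨h1', h2', h3'⟩ := h'
  -- At a non-atomic type an `η`-long term must be an abstraction; the type then selects the kind.
  have key : ∀ {n Γ u A}, EtaLong n Γ u A → (∀ X, A ≠ .fvar X) →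
      (∃ B s, u = .lam B s) ∨ ∃ s, u = .tlam s := by
    intro n Γ u A hu hA
    by_contra hc
    push Not at hc
    obtain ⟨⟨X, hX⟩, _⟩ := hu.atomic hc.1 hc.2
    exact hA X hX
  induction t generalizing n Γ A t' with
  | lam B t ih =>
    cases h1 with
    | @lam _ _ _ _ C hB h1 =>
      rcases key ⟨h1', h2', h3'⟩ (by simp) with ⟨B', s, rfl⟩ | ⟨s, rfl⟩
      · cases h1' with
        | @lam _ _ _ _ _ _ h1' => rw [ih (t' := s) hb h1 h2 h3 h1' h2' h3']
      · cases h1'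
  | tlam t ih =>
    cases h1 with
    | @tlam _ _ _ C hB h1 =>
      rcases key ⟨h1', h2', h3'⟩ (by simp) with ⟨B', s, rfl⟩ | ⟨s, rfl⟩
      · cases h1'
      · cases h1' with
        | @tlam _ _ _ _ _ h1' => rw [ih (t' := s) hb h1 h2 h3 h1' h2' h3']
  | _ =>
    obtain ⟨⟨X, rfl⟩, hh⟩ := (EtaLong.mk h1 h2 h3).atomic (by simp) (by simp)
    have : t'.body = t' := by
      cases t' with
      | lam => cases h1'
      | tlam => cases h1'
      | _ => rfl
    exact hb.trans this

/-- An `η`-long term is determined by its type, its head variable and the arguments of this. -/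
theorem EtaLong.eq_of_args_eq {n : ℕ} {Γ : List Ty} {t t' : Tm} {A : Ty} (h : EtaLong n Γ t A)
    (h' : EtaLong n Γ t' A) (hx : t.body.headVar = t'.body.headVar)
    (hV : t.body.tyArgs = t'.body.tyArgs) (hu : t.body.tmArgs = t'.body.tmArgs) : t = t' := by
  refine h.eq_of_body_eq h' ?_
  obtain ⟨S, X, hS, hl, hX, hh, hb⟩ := h.body
  obtain ⟨S₁, X₁, hS₁, hl₁, hX₁, hh₁, hb₁⟩ := h'.body
  have hk := resolve_blackBoxes_unique hS hS₁
  rw [← hk] at hS₁ hb₁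
  obtain rfl := Option.some.inj (hS.symm.trans hS₁)
  obtain ⟨x, hx'⟩ := Option.isSome_iff_exists.1 hh
  obtain ⟨B, hB, hs, _⟩ := hb.hasType.spine hb.betaNormal hb.etaExpanded hx'
  obtain ⟨B₁, hB₁, hs₁, _⟩ := hb₁.hasType.spine hb₁.betaNormal hb₁.etaExpanded (hx ▸ hx')
  obtain rfl := Option.some.inj (hB.symm.trans hB₁)
  rw [← hV, ← hu] at hs₁
  exact hs.unique hs₁

/-- Every type is resolved by black boxes, and its `η`-long terms can be built from neutral
terms. -/
theorem exists_etaLong_of_body {n : ℕ} {A : Ty} (hA : A.WF n) :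
    ∃ k S, A.resolve (blackBoxes n k) = some S ∧ ∀ Γ b X, S.colour = some X →
      EtaLong (n + k) (S.branches.reverse ++ Γ) b (.fvar X) → b.headVar.isSome →
      ∃ t, EtaLong n Γ t A ∧ t.tlams = k ∧ t.lams = S.branches.length ∧ t.body = b := by
  simp only [Ty.resolve_eq_some]
  generalize hm : A.size = m
  induction m using Nat.strong_induction_on generalizing n A with
  | _ m ih =>
  cases A with
  | fvar x =>
    refine ⟨0, .fvar x, ⟨by simp, rfl, x, rfl⟩, fun Γ b X hX hb hx => ?_⟩
    obtain rfl : x = X := by simpa [Ty.colour] using hX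
    exact ⟨b, hb, Tm.prefix_of_headVar hx⟩
  | bvar i => exact absurd hA.1 (Nat.not_lt_zero i)
  | arr A B =>
    obtain ⟨k, S, ⟨r1, r2, X, hX⟩, hb⟩ := ih B.size (by rw [← hm, Ty.size]; omega) hA.right rfl
    refine ⟨k, .arr A S, ⟨r1, by simp [Ty.impAll_arr, r2], X, hX⟩, fun Γ b X hX hb' hx => ?_⟩
    obtain ⟨t, ht, h1, h2, h3⟩ := hb (A :: Γ) b X hX (by simpa [Ty.branches] using hb') hx
    exact ⟨.lam A t, ⟨.lam hA.left ht.hasType, ht.betaNormal, ht.etaExpanded⟩, h1,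
      by simp [Tm.lams, h2, Ty.branches], h3⟩
  | all A =>
    obtain ⟨k, S, ⟨r1, r2, r3⟩, hb⟩ := ih (A.inst (.fvar n)).size
      (by rw [← hm, Ty.inst, Ty.size_instAt_fvar, Ty.size]; omega)
      (Ty.WF.inst (n := n + 1) (hA.mono (by omega)) (Ty.WF.fvar (by omega))) rfl
    refine ⟨k + 1, S, ⟨fun V => LC_of_mem_blackBoxes, ?_, r3⟩, fun Γ b X hX hb' hx => ?_⟩
    · rw [blackBoxes_succ, Ty.impAll_all, r2]
    · rw [show n + (k + 1) = n + 1 + k by omega] at hb'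
      obtain ⟨t, ht, h1, h2, h3⟩ := hb Γ b X hX hb' hx
      exact ⟨.tlam t, ⟨.tlam hA ht.hasType, ht.betaNormal, ht.etaExpanded⟩, by simp [Tm.tlams, h1],
        h2, h3⟩

/-- Every type is resolved by black boxes, and `η`-long terms can be built from a head variable and
its arguments. -/
theorem exists_etaLong {n : ℕ} {A : Ty} (hA : A.WF n) :
    ∃ k S X, A.resolve (blackBoxes n k) = some S ∧ S.colour = some X ∧
      ∀ Γ x A' Vs S' us, (S.branches.reverse ++ Γ)[x]? = some A' → (∀ V ∈ Vs, V.WF (n + k)) →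
        A'.resolve Vs = some S' → S'.colour = some X → us.length = S'.branches.length →
        (∀ (j : ℕ) u C, us[j]? = some u → S'.branches[j]? = some C →
          EtaLong (n + k) (S.branches.reverse ++ Γ) u C) →
        ∃ t, EtaLong n Γ t A ∧ t.tlams = k ∧ t.lams = S.branches.length ∧
          t.body.headVar = some x ∧ t.body.tyArgs = Vs ∧ t.body.tmArgs = us := by
  obtain ⟨k, S, hS, hb⟩ := exists_etaLong_of_body hA
  obtain ⟨X, hX⟩ := (Ty.resolve_eq_some.1 hS).2.2
  refine ⟨k, S, X, hS, hX, fun Γ x A' Vs S' us hx hV hS' hX' hlen hu => ?_⟩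
  obtain ⟨b, hs⟩ := Tm.Spine.exists_of_impAll (h := .var x) (Ty.resolve_eq_some.1 hS').2.1 hX' hlen hu
  obtain ⟨e1, e2, e3⟩ := hs.headVar_eq
  have hb' := hs.etaLong hV (.var hx) trivial (by simp [EtaExpanded]) rfl
  obtain ⟨t, ht, h1, h2, h3⟩ := hb Γ b X hX hb' (by rw [e1]; rfl)
  exact ⟨t, ht, h1, h2, by rw [h3, e1]; rfl, by rw [h3, e2]; rfl, by rw [h3, e3]; rfl⟩

/-! ### States and moves -/

/-- The type that is entered from a state through branch `i`. -/
def State.entry (T : Ty) : State → ℕ → Option Ty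
  | .star, i => if i = 1 then some T else none
  | .ty S, i => if 1 ≤ i then S.branches[i - 1]? else none

theorem State.entry_ty_succ (T S : Ty) (j : ℕ) : (State.ty S).entry T (j + 1) = S.branches[j]? := by
  simp [State.entry]

theorem State.entry_ty {T S A : Ty} {i : ℕ} (h : (State.ty S).entry T i = some A) :
    ∃ j, i = j + 1 ∧ S.branches[j]? = some A := by
  simp only [State.entry] at h
  split_ifs at h with hi
  exact ⟨i - 1, by omega, h⟩

/-- A transition is the choice of a type by the branch, followed by its resolution by the imports.
This treats the initial move and all later ones alike. -/
theorem hyper_step {T : Ty} {q q' : State} {l : Label} : (hyper T).step q l = some q' ↔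
    ∃ A S, q.entry T l.branch = some A ∧ A.resolve l.imports = some S ∧ q' = .ty S := by
  obtain ⟨i, Vs⟩ := l
  cases q with
  | star =>
    simp only [hyper, State.entry]
    split_ifs <;> simp [eq_comm]
  | ty S =>
    simp only [hyper, State.entry]
    split_ifs
    · simp only [Option.bind_eq_some_iff, Option.map_eq_some_iff, exists_and_left, @eq_comm _ q']
    · simp

/-- The move `(a, l)` is possible after `d`, whose positions have the states `st`, and leads to the
state `q`. -/
structure Move (T : Ty) (d : Dialogue) (st : ℕ → State) (a : ℕ) (l : Label) (q : State) :
    Prop where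
  le : a ≤ d.length
  odd : Odd (d.length + 1 - a)
  step : (hyper T).step (st a) l = some q
  opponent : Odd (d.length + 1) →
    a = d.length ∧ l.imports = blackBoxes (oImports d).length l.imports.length
  proponent : Even (d.length + 1) → ∀ V ∈ l.imports, ∀ x ∈ V.fv, Ty.fvar x ∈ oImports d

/-- The dialogue `d` is in the black box game, and `st` are the states of its positions. -/
def Legal (T : Ty) (d : Dialogue) (st : ℕ → State) : Prop :=
  st 0 = .star ∧ ∀ i a l, d[i]? = some (a, l) → Move T (d.take i) st a l (st (i + 1))

theorem Move.congr {T : Ty} {d : Dialogue} {st st' : ℕ → State} {a : ℕ} {l : Label} {q : State}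
    (h : Move T d st a l q) (hst : ∀ j ≤ d.length, st j = st' j) : Move T d st' a l q :=
  ⟨h.le, h.odd, hst a h.le ▸ h.step, h.opponent, h.proponent⟩

theorem lt_length_of_getElem? {M : Type*} {d : List M} {i : ℕ} {m : M} (h : d[i]? = some m) :
    i < d.length := (List.getElem?_eq_some_iff.1 h).1

theorem Legal.congr {T : Ty} {d : Dialogue} {st st' : ℕ → State} (h : Legal T d st)
    (hst : ∀ j ≤ d.length, st j = st' j) : Legal T d st' := by
  refine ⟨hst 0 (Nat.zero_le _) ▸ h.1, fun i a l hi => ?_⟩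
  have hlt := lt_length_of_getElem? hi
  rw [← hst (i + 1) hlt]
  exact (h.2 i a l hi).congr fun j hj => hst j (hj.trans (by simp))

theorem Legal.nil (T : Ty) : Legal T [] fun _ => .star := ⟨rfl, by simp⟩

theorem Legal.prefix {T : Ty} {d e : Dialogue} {st : ℕ → State} (h : Legal T (d ++ e) st) :
    Legal T d st := by
  refine ⟨h.1, fun i a l hi => ?_⟩
  have hlt := lt_length_of_getElem? hi
  have := h.2 i a l (by rw [List.getElem?_append_left hlt, hi])
  rwa [List.take_append_of_le_length hlt.le] at this

theorem Legal.move {T : Ty} {d : Dialogue} {st : ℕ → State} {a : ℕ} {l : Label}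
    (h : Legal T (d ++ [(a, l)]) st) : Move T d st a l (st (d.length + 1)) := by
  simpa using h.2 d.length a l (by simp)

theorem Legal.snoc {T : Ty} {d : Dialogue} {st : ℕ → State} {a : ℕ} {l : Label}
    (h : Legal T d st) (hm : Move T d st a l (st (d.length + 1))) :
    Legal T (d ++ [(a, l)]) st := by
  refine ⟨h.1, fun i b k hi => ?_⟩
  rcases lt_or_ge i d.length with hlt | hge
  · rw [List.getElem?_append_left hlt] at hi
    rw [List.take_append_of_le_length hlt.le]
    exact h.2 i b k hi
  · have := lt_length_of_getElem? hi
    simp only [List.length_append, List.length_singleton] at this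
    obtain rfl : i = d.length := by omega
    simp only [List.getElem?_concat_length, Option.some.injEq, Prod.mk.injEq] at hi
    obtain ⟨rfl, rfl⟩ := hi
    simpa using hm

/-- The transition system is deterministic. The induction is strong because a pointer may lead to
any earlier position. -/
theorem Legal.unique {T : Ty} {d : Dialogue} {st st' : ℕ → State} (h : Legal T d st)
    (h' : Legal T d st') : ∀ j ≤ d.length, st j = st' j := by
  intro j
  induction j using Nat.strong_induction_on with
  | _ j ih =>
  intro hj
  cases j with
  | zero => rw [h.1, h'.1]
  | succ i =>
    have hi : d[i]? = some (d[i].1, d[i].2) := List.getElem?_eq_getElem (by omega)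
    have h1 := h.2 i _ _ hi
    have h2 := h'.2 i _ _ hi
    have hle := h1.le
    rw [List.length_take] at hle
    have h3 := h2.step
    rw [← ih (d[i]'(by omega)).1 (by omega) (by omega)] at h3
    exact Option.some.inj (h1.step.symm.trans h3)

/-! ### Threads -/

theorem ThreadTo.unique {M : Type*} {d : List (ℕ × M)} {j : ℕ} {s s' : List M}
    (h : ThreadTo d j s) (h' : ThreadTo d j s') : s = s' := by
  induction h generalizing s' with
  | nil => cases h'; rfl
  | snoc _ hi ih =>
    cases h' with
    | snoc h' hi' =>
      rw [hi, Option.some.injEq, Prod.mk.injEq] at hi'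
      obtain ⟨rfl, rfl⟩ := hi'
      rw [ih h']

theorem exists_threadTo {M : Type*} {d : List (ℕ × M)} (h : IsDialogue d) (j : ℕ)
    (hj : j ≤ d.length) : ∃ s, ThreadTo d j s := by
  induction j using Nat.strong_induction_on with
  | _ j ih =>
  cases j with
  | zero => exact ⟨[], .nil⟩
  | succ i =>
    have hi : d[i]? = some (d[i].1, d[i].2) := List.getElem?_eq_getElem (by omega)
    have hle := (h i _ _ hi).1
    obtain ⟨s, hs⟩ := ih (d[i]'(by omega)).1 (by omega) (by omega)
    exact ⟨_, hs.snoc hi⟩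

theorem TransitionSystem.run_concat {Q L : Type*} (Δ : TransitionSystem Q L) (s : List L) (l : L) :
    Δ.run (s ++ [l]) = (Δ.run s).bind fun q => Δ.step q l := by
  simp only [TransitionSystem.run, List.foldlM_append]
  change Option.bind _ _ = _
  congr
  funext q
  simp

theorem Legal.run_eq {T : Ty} {d : Dialogue} {st : ℕ → State} (h : Legal T d st) {j : ℕ}
    {s : List Label} (hs : ThreadTo d j s) : (hyper T).run s = some (st j) := by
  induction hs with
  | nil => rw [h.1]; rfl
  | snoc _ hi ih => rw [TransitionSystem.run_concat, ih]; exact (h.2 _ _ _ hi).step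

theorem Legal.isDialogue {T : Ty} {d : Dialogue} {st : ℕ → State} (h : Legal T d st) :
    IsDialogue d := by
  intro i a l hi
  have hlt := lt_length_of_getElem? hi
  have hm := h.2 i a l hi
  have hlen : (d.take i).length = i := by simp; omega
  exact ⟨hlen ▸ hm.le, hlen ▸ hm.odd⟩

theorem Legal.mem_blackBoxGame {T : Ty} {d : Dialogue} {st : ℕ → State} (h : Legal T d st) :
    d ∈ blackBoxGame T := by
  have hlen : ∀ {i a l}, d[i]? = some (a, l) → (d.take i).length = i := by
    intro i a l hi
    have := lt_length_of_getElem? hi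
    simp; omega
  refine ⟨⟨⟨h.isDialogue, fun j s hs => ⟨_, h.run_eq hs⟩⟩, fun i a l hi ho => ?_⟩,
    fun i a l hi ho => ?_, fun i a l hi ho => ?_⟩
  · exact (((h.2 i a l hi).opponent (by rwa [hlen hi])).1).trans (hlen hi)
  · exact ((h.2 i a l hi).opponent (by rwa [hlen hi])).2
  · exact (h.2 i a l hi).proponent (by rwa [hlen hi])

/-- Each position of a dialogue ends exactly one thread, whose final state is taken. Positions
beyond the end have no thread and get the dummy state `star`. -/
theorem exists_legal {T : Ty} {d : Dialogue} (h : d ∈ blackBoxGame T) : ∃ st, Legal T d st := by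
  obtain ⟨⟨⟨hd, hG⟩, hO⟩, hB, hP⟩ := h
  have hex : ∀ j, ∃ q, ∀ s, ThreadTo d j s → (hyper T).run s = some q := by
    intro j
    by_cases hj : ∃ s, ThreadTo d j s
    · obtain ⟨s, hs⟩ := hj
      obtain ⟨q, hq⟩ := hG j s hs
      exact ⟨q, fun s' hs' => ThreadTo.unique hs hs' ▸ hq⟩
    · exact ⟨.star, fun s hs => absurd ⟨s, hs⟩ hj⟩
  choose st hst using hex
  refine ⟨st, (Option.some.inj (hst 0 [] .nil)).symm, fun i a l hi => ?_⟩
  have hlt := lt_length_of_getElem? hi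
  have hlen : (d.take i).length = i := by simp; omega
  obtain ⟨s, hs⟩ := exists_threadTo hd a (by have := (hd i a l hi).1; omega)
  have hstep := hst _ _ (hs.snoc hi)
  rw [TransitionSystem.run_concat, hst _ _ hs] at hstep
  refine ⟨hlen.symm ▸ (hd i a l hi).1, hlen.symm ▸ (hd i a l hi).2, hstep, ?_, ?_⟩
  · rw [hlen]
    exact fun ho => ⟨hO i a l hi ho, hB i a l hi ho⟩
  · rw [hlen]
    exact hP i a l hi

theorem Legal.hasColour {T : Ty} {d : Dialogue} {st : ℕ → State} (h : Legal T d st) {j X : ℕ}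
    (hj : j ≤ d.length) : HasColour T d j X ↔ ∃ S, st j = .ty S ∧ S.colour = some X := by
  constructor
  · rintro ⟨s, S, hs, hr, hX⟩
    exact ⟨S, Option.some.inj ((h.run_eq hs).symm.trans hr), hX⟩
  · rintro ⟨S, hS, hX⟩
    obtain ⟨s, hs⟩ := exists_threadTo h.isDialogue j hj
    exact ⟨s, S, hs, hS ▸ h.run_eq hs, hX⟩

/-- A move after a dialogue with known states. -/
theorem Legal.exists_move {T : Ty} {d : Dialogue} {st : ℕ → State} {m : ℕ × Label}
    (h : Legal T d st) (hm : d ++ [m] ∈ blackBoxGame T) : ∃ q, Move T d st m.1 m.2 q := by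
  obtain ⟨st', h'⟩ := exists_legal hm
  exact ⟨_, Move.congr (Legal.move h') (h'.prefix.unique h)⟩

theorem Legal.extend {T : Ty} {d : Dialogue} {st : ℕ → State} {a : ℕ} {l : Label} {q : State}
    (h : Legal T d st) (hm : Move T d st a l q) :
    Legal T (d ++ [(a, l)]) (Function.update st (d.length + 1) q) := by
  have hst : ∀ j ≤ d.length, st j = Function.update st (d.length + 1) q j := fun j hj => by
    rw [Function.update_of_ne (by omega)]
  refine (h.congr hst).snoc ?_
  rw [Function.update_self]
  exact hm.congr hst

theorem oImports_append {d e : Dialogue} (h : Even d.length) :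
    oImports (d ++ e) = oImports d ++ oImports e := by
  induction d using oImports.induct with
  | case1 => rfl
  | case2 m => simp at h
  | case3 m m' d ih =>
    have : Even d.length := by
      simp only [List.length_cons] at h
      rw [Nat.even_iff] at h ⊢
      omega
    simp [oImports, ih this]

section

/-! ### Configurations -/

/-- The term variables in scope, of types `Γ`, stand for all the branches of the states `st` of the
moves of `O` in the first `N` positions, as recorded by `ρ`. -/
structure Scope (T : Ty) (N : ℕ) (st : ℕ → State) (n : ℕ) (ρ : List (ℕ × ℕ)) (Γ : List Ty) :
    Prop where
  length : ρ.length = Γ.length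
  lookup : ∀ (x : ℕ) q b, ρ[x]? = some (q, b) → Odd q ∧ q ≤ N ∧ Γ[x]? = (st q).entry T b
  complete : ∀ q b A, Odd q → q ≤ N → (st q).entry T b = some A → ∃ x : ℕ, ρ[x]? = some (q, b)
  wf : ∀ A ∈ Γ, A.WF n

/-- In the first `N` positions, the moves of `P` have the colours of the preceding moves. -/
def CopycatStates (N : ℕ) (st : ℕ → State) : Prop :=
  ∀ j, Even (j + 1) → j + 1 ≤ N → ∃ X S S', st j = .ty S ∧ S.colour = some X ∧
    st (j + 1) = .ty S' ∧ S'.colour = some X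

/-- The situation after the dialogue `d` of even length, when `O` is about to enter a term with the
type variables below `n` and the term variables of types `Γ` in scope. -/
structure Config (T : Ty) (d : Dialogue) (st : ℕ → State) (n : ℕ) (ρ : List (ℕ × ℕ))
    (Γ : List Ty) : Prop where
  legal : Legal T d st
  even : Even d.length
  copycat : CopycatStates d.length st
  imports : oImports d = blackBoxes 0 n
  scope : Scope T d.length st n ρ Γ
  wf_entry : ∀ i A, (st d.length).entry T i = some A → A.WF n

namespace Tm

@[simp] theorem length_binders (q m : ℕ) : (binders q m).length = m := by simp [binders]

theorem getElem?_binders {q m x : ℕ} (hx : x < m) : (binders q m)[x]? = some (q, m - 1 - x + 1) := by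
  simp [binders, hx]

end Tm

/-- The branches of the state reached by `O` become the new `λ`-bound variables. Contexts list the
innermost variable first, hence the reversal on both sides. -/
theorem Scope.push {T : Ty} {N : ℕ} {st : ℕ → State} {n k : ℕ} {ρ : List (ℕ × ℕ)} {Γ : List Ty}
    (h : Scope T N st n ρ Γ) (hN : Even N) {S : Ty} (hS : S.WF (n + k)) :
    Scope T (N + 1) (Function.update st (N + 1) (.ty S)) (n + k)
      (Tm.binders (N + 1) S.branches.length ++ ρ) (S.branches.reverse ++ Γ) := by
  refine ⟨by simp [h.length], fun x q b hx => ?_, fun q b A hq hqN hA => ?_, fun A hA => ?_⟩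
  · rcases lt_or_ge x S.branches.length with hlt | hge
    · rw [List.getElem?_append_left (by simpa using hlt), Tm.getElem?_binders hlt] at hx
      simp only [Option.some.injEq, Prod.mk.injEq] at hx
      obtain ⟨rfl, rfl⟩ := hx
      refine ⟨hN.add_one, le_rfl, ?_⟩
      rw [Function.update_self, State.entry_ty_succ,
        List.getElem?_append_left (by simpa using hlt), List.getElem?_reverse hlt]
    · rw [List.getElem?_append_right (by simpa using hge)] at hx
      rw [List.getElem?_append_right (by simpa using hge)]
      simp only [Tm.length_binders, List.length_reverse] at hx ⊢
      obtain ⟨h1, h2, h3⟩ := h.lookup _ q b hx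
      exact ⟨h1, by omega, by rw [Function.update_of_ne (by omega), h3]⟩
  · rcases Nat.lt_or_ge N q with hlt | hge
    · obtain rfl : q = N + 1 := by omega
      rw [Function.update_self] at hA
      obtain ⟨j, rfl, hj⟩ := State.entry_ty hA
      have hj' := lt_length_of_getElem? hj
      refine ⟨S.branches.length - 1 - j, ?_⟩
      rw [List.getElem?_append_left (by simp; omega), Tm.getElem?_binders (by omega)]
      simp only [Option.some.injEq, Prod.mk.injEq, true_and]
      omega
    · rw [Function.update_of_ne (by omega)] at hA
      obtain ⟨x, hx⟩ := h.complete q b A hq hge hA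
      refine ⟨S.branches.length + x, ?_⟩
      rw [List.getElem?_append_right (by simp)]
      simpa using hx
  · simp only [List.mem_append, List.mem_reverse] at hA
    rcases hA with hA | hA
    · exact hS.branches hA
    · exact (h.wf A hA).mono (by omega)

/-- A move of `P` has an even position, and only branches at odd positions are variables. -/
theorem Scope.skip {T : Ty} {N : ℕ} {st : ℕ → State} {n : ℕ} {ρ : List (ℕ × ℕ)} {Γ : List Ty}
    (h : Scope T N st n ρ Γ) (hN : Odd N) (q : State) :
    Scope T (N + 1) (Function.update st (N + 1) q) n ρ Γ := by
  refine ⟨h.length, fun x r b hx => ?_, fun r b A hr hrN hA => ?_, h.wf⟩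
  · obtain ⟨h1, h2, h3⟩ := h.lookup x r b hx
    exact ⟨h1, by omega, by rw [Function.update_of_ne (by omega), h3]⟩
  · have : r ≠ N + 1 := by
      rintro rfl
      rw [Nat.odd_iff] at hN hr
      omega
    rw [Function.update_of_ne this] at hA
    exact h.complete r b A hr (by omega) hA

variable {T : Ty} {d : Dialogue} {st : ℕ → State} {n : ℕ} {ρ : List (ℕ × ℕ)} {Γ : List Ty}

theorem Config.move_opponent (h : Config T d st n ρ Γ) {i k : ℕ} {A S : Ty}
    (hA : (st d.length).entry T i = some A) (hS : A.resolve (blackBoxes n k) = some S) :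
    Move T d st d.length ⟨i, blackBoxes n k⟩ (.ty S) := by
  refine ⟨le_rfl, by simp, hyper_step.2 ⟨A, S, hA, hS, rfl⟩, fun _ => ⟨rfl, ?_⟩, fun he => ?_⟩
  · simp [h.imports]
  · exact absurd h.even.add_one (Nat.not_odd_iff_even.2 he)

theorem Config.of_move_opponent (h : Config T d st n ρ Γ) {a : ℕ} {l : Label} {q : State}
    (hm : Move T d st a l q) : a = d.length ∧ ∃ k A S, l.imports = blackBoxes n k ∧
      (st d.length).entry T l.branch = some A ∧ A.resolve (blackBoxes n k) = some S := by
  obtain ⟨rfl, hl⟩ := hm.opponent h.even.add_one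
  obtain ⟨A, S, hA, hS, rfl⟩ := hyper_step.1 hm.step
  simp only [h.imports, length_blackBoxes] at hl
  exact ⟨rfl, _, A, S, hl, hA, hl ▸ hS⟩

/-- The branch is the only freedom of `O`: the pointer is forced, the names of the black boxes are
canonical, and their number is dictated by the type. -/
theorem Config.unique_opponent (h : Config T d st n ρ Γ) {m : ℕ × Label} {k : ℕ} {A S : Ty}
    (hm : d ++ [m] ∈ blackBoxGame T) (hA : (st d.length).entry T m.2.branch = some A)
    (hS : A.resolve (blackBoxes n k) = some S) :
    m = (d.length, ⟨m.2.branch, blackBoxes n k⟩) := by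
  obtain ⟨q, hq⟩ := h.legal.exists_move hm
  obtain ⟨h1, k', A', S', h2, h3, h4⟩ := h.of_move_opponent hq
  obtain rfl := Option.some.inj (hA.symm.trans h3)
  obtain rfl := resolve_blackBoxes_unique hS h4
  obtain ⟨a, i, Vs⟩ := m
  simp only at h1 h2
  rw [h1, h2]

/-- The configuration after a move of `O` and a copycat answer of `P`. -/
theorem Config.round (h : Config T d st n ρ Γ) {i k a X : ℕ} {l : Label} {A S S' : Ty}
    (hA : (st d.length).entry T i = some A) (hS : A.resolve (blackBoxes n k) = some S)
    (hX : S.colour = some X) (hX' : S'.colour = some X)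
    (hm : Move T (d ++ [(d.length, ⟨i, blackBoxes n k⟩)])
      (Function.update st (d.length + 1) (.ty S)) a l (.ty S')) :
    Config T (d ++ [(d.length, ⟨i, blackBoxes n k⟩), (a, l)])
      (Function.update (Function.update st (d.length + 1) (.ty S)) (d.length + 2) (.ty S')) (n + k)
      (Tm.binders (d.length + 1) S.branches.length ++ ρ) (S.branches.reverse ++ Γ) := by
  have hlegal := (h.legal.extend (h.move_opponent hA hS)).extend hm
  have hSwf : S.WF (n + k) :=
    ((h.wf_entry i A hA).mono (by omega)).impAll (fun V hV => WF_of_mem_blackBoxes hV)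
      (Ty.resolve_eq_some.1 hS).2.1
  have hscope := h.scope.push h.even hSwf
  have himp : oImports (d ++ [(d.length, ⟨i, blackBoxes n k⟩)]) = blackBoxes 0 (n + k) := by
    rw [oImports_append h.even, h.imports, blackBoxes_add, Nat.zero_add]; rfl
  simp only [List.append_assoc, List.length_append, List.length_singleton] at hlegal
  have ha := hm.le
  have ho := hm.odd
  have hp := h.even
  rw [List.length_append, List.length_singleton] at ha ho
  refine ⟨hlegal, ?_, ?_, ?_, ?_, ?_⟩
  · simpa [Nat.even_add_one] using h.even
  · intro j hj hjd
    simp only [List.length_append, List.length_cons, List.length_nil] at hjd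
    rcases Nat.lt_or_ge d.length (j + 1) with hlt | hge
    · obtain rfl : j = d.length + 1 := by
        rw [Nat.even_iff] at hj hp
        omega
      exact ⟨X, S, S', by rw [Function.update_of_ne (by omega), Function.update_self], hX,
        by rw [Function.update_self], hX'⟩
    · rw [Function.update_of_ne (by omega), Function.update_of_ne (by omega),
        Function.update_of_ne (by omega), Function.update_of_ne (by omega)]
      exact h.copycat j hj hge
  · rw [oImports_append h.even, h.imports, blackBoxes_add, Nat.zero_add]
    simp [oImports]
  · simpa using hscope.skip h.even.add_one (.ty S')
  · intro j B hB
    simp only [List.length_append, List.length_cons, List.length_nil, Nat.zero_add, Nat.reduceAdd,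
      Function.update_self] at hB
    obtain ⟨j, rfl, hj⟩ := State.entry_ty hB
    refine Ty.WF.branches ?_ (List.mem_of_getElem? hj)
    obtain ⟨A', S'', hA', hS'', he⟩ := hyper_step.1 hm.step
    cases he
    have hodd : Odd a := by
      rw [Nat.odd_iff] at ho ⊢
      rw [Nat.even_iff] at hp
      omega
    -- The branch chosen by `P` is a variable in scope, so its type is well formed below `n + k`.
    -- The imports are too, by the black box rule.
    obtain ⟨x, hx⟩ := hscope.complete a l.branch A' hodd ha hA'
    have hx' := (hscope.lookup x _ _ hx).2.2
    rw [hA'] at hx'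
    obtain ⟨r1, r2, _⟩ := Ty.resolve_eq_some.1 hS''
    refine (hscope.wf A' (List.mem_of_getElem? hx')).impAll (fun V hV => ⟨r1 V hV, ?_⟩) r2
    intro y hy
    have := hm.proponent (by simpa [Nat.even_add_one] using h.even) V hV y hy
    rwa [himp, fvar_mem_blackBoxes_zero] at this

/-- The configuration after a move of `O` that enters the term `t` and the answer according to
`t`. -/
theorem Config.round_of_etaLong (h : Config T d st n ρ Γ) {i : ℕ} {A : Ty} {t : Tm}
    (hA : (st d.length).entry T i = some A) (ht : EtaLong n Γ t A) :
    ∃ (x q b : ℕ) (st' : ℕ → State) (Γ' : List Ty), t.body.headVar = some x ∧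
      (Tm.binders (d.length + 1) t.lams ++ ρ)[x]? = some (q, b) ∧
      Config T (d ++ [(d.length, ⟨i, blackBoxes n t.tlams⟩), (q, ⟨b, t.body.tyArgs⟩)]) st'
        (n + t.tlams) (Tm.binders (d.length + 1) t.lams ++ ρ) Γ' ∧
      (∀ (j : ℕ) u, t.body.tmArgs[j]? = some u → ∃ C, (st' (d.length + 2)).entry T (j + 1) = some C ∧
        EtaLong (n + t.tlams) Γ' u C) ∧
      ∀ i' C, (st' (d.length + 2)).entry T i' = some C →
        ∃ (j : ℕ) (u : Tm), i' = j + 1 ∧ t.body.tmArgs[j]? = some u := by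
  obtain ⟨S, X, x, A', S', hS, hl, hX, hx, hA', hV, hS', hX', hlen, hu⟩ := ht.decompose
  have hSwf : S.WF (n + t.tlams) :=
    ((h.wf_entry i A hA).mono (by omega)).impAll (fun V hV => WF_of_mem_blackBoxes hV)
      (Ty.resolve_eq_some.1 hS).2.1
  have hscope := h.scope.push h.even hSwf
  obtain ⟨⟨q, b⟩, hqb⟩ : ∃ qb, (Tm.binders (d.length + 1) S.branches.length ++ ρ)[x]? = some qb :=
    ⟨_, List.getElem?_eq_getElem (hscope.length ▸ lt_length_of_getElem? hA')⟩
  obtain ⟨h1, h2, h3⟩ := hscope.lookup x q b hqb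
  have hp := h.even
  have hm : Move T (d ++ [(d.length, ⟨i, blackBoxes n t.tlams⟩)])
      (Function.update st (d.length + 1) (.ty S)) q ⟨b, t.body.tyArgs⟩ (.ty S') := by
    refine ⟨by simpa using h2, ?_, hyper_step.2 ⟨A', S', h3 ▸ hA', hS', rfl⟩, fun ho => ?_,
      fun _ V hV' y hy => ?_⟩
    · rw [List.length_append, List.length_singleton]
      rw [Nat.odd_iff] at h1 ⊢
      rw [Nat.even_iff] at hp
      omega
    · rw [List.length_append, List.length_singleton, Nat.odd_iff] at ho
      rw [Nat.even_iff] at hp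
      omega
    · rw [oImports_append h.even, h.imports, oImports]
      have e := blackBoxes_add 0 n t.tlams
      rw [Nat.zero_add] at e
      rw [← e, fvar_mem_blackBoxes_zero]
      simpa using (hV V hV').2 y hy
  refine ⟨x, q, b, _, _, hx, hl ▸ hqb, hl ▸ h.round hA hS hX hX' hm, fun j u hj => ?_,
    fun i' C hC => ?_⟩
  · rw [Function.update_self, State.entry_ty_succ]
    exact hu j u hj
  · rw [Function.update_self] at hC
    obtain ⟨j, rfl, hj⟩ := State.entry_ty hC
    exact ⟨j, _, rfl, List.getElem?_eq_getElem (hlen ▸ lt_length_of_getElem? hj)⟩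

theorem Config.init (hT : T.IsClosed) : Config T [] (fun _ => .star) 0 [] [] := by
  refine ⟨Legal.nil T, by simp, fun j _ hj => by simp at hj, rfl,
    ⟨rfl, by simp, fun q b A hq hq0 => ?_, by simp⟩, fun i A hA => ?_⟩
  · simp only [List.length_nil, Nat.le_zero] at hq0
    subst hq0
    simp at hq
  · simp only [State.entry] at hA
    split_ifs at hA
    cases hA
    exact ⟨hT.1, by simp [hT.2]⟩

end

section

/-! ### The plays of a term -/

namespace Tm

theorem Plays.cons_eq {n p : ℕ} {ρ : List (ℕ × ℕ)} {i : ℕ} {t : Tm} {m : ℕ × Label} {s : Dialogue}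
    (h : Plays n p ρ i t (m :: s)) : m = (p, ⟨i, blackBoxes n t.tlams⟩) := by
  cases h <;> rfl

/-- Plays are generated from the front, but prefix closure removes the last move; hence the case
distinction on the rest `r`. -/
theorem Plays.of_concat {n p : ℕ} {ρ : List (ℕ × ℕ)} {i : ℕ} {t : Tm} {m : ℕ × Label}
    {s : Dialogue} (h : Plays n p ρ i t (s ++ [m])) : Plays n p ρ i t s := by
  generalize hr : s ++ [m] = r at h
  induction h generalizing s with
  | nil => simp at hr
  | enter =>
    obtain ⟨rfl, _⟩ := List.append_inj' (t₁ := [m]) (s₂ := []) hr rfl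
    exact .nil
  | answer hx hq =>
    obtain ⟨rfl, _⟩ := List.append_inj' (t₁ := [m]) (s₂ := [_]) hr rfl
    exact .enter
  | @next n p ρ i t x q b j u r hx hq hu hr' ih =>
    rcases List.eq_nil_or_concat' r with rfl | ⟨r, m', rfl⟩
    · obtain ⟨rfl, _⟩ := List.append_inj' (t₁ := [m]) (s₂ := [_]) hr rfl
      exact .enter
    · obtain ⟨rfl, e⟩ := List.append_inj' (t₁ := [m]) (s₁ := s) (s₂ := _ :: _ :: r) (t₂ := [m'])
        (by simpa using hr) rfl
      exact .next hx hq hu (ih (congrArg (r ++ ·) e))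

/-- After an odd number of moves it is the turn of `P`, whose answer is fixed by the head variable
and its type arguments. -/
theorem Plays.concat_unique {n p : ℕ} {ρ : List (ℕ × ℕ)} {i : ℕ} {t : Tm} {m m' : ℕ × Label}
    {s : Dialogue} (h : Plays n p ρ i t (s ++ [m])) (h' : Plays n p ρ i t (s ++ [m']))
    (hs : Odd s.length) : m = m' := by
  generalize hr : s ++ [m] = r at h
  induction h generalizing s with
  | nil => simp at hr
  | enter =>
    obtain ⟨rfl, _⟩ := List.append_inj' (t₁ := [m]) (s₂ := []) hr rfl
    simp at hs
  | answer hx hq =>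
    obtain ⟨rfl, e⟩ := List.append_inj' (t₁ := [m]) (s₂ := [_]) hr rfl
    simp only [List.cons.injEq, and_true] at e
    cases h' with
    | answer hx' hq' =>
      rw [hx, Option.some.injEq] at hx'
      subst hx'
      rw [hq, Option.some.injEq, Prod.mk.injEq] at hq'
      obtain ⟨rfl, rfl⟩ := hq'
      exact e
    | next hx' hq' =>
      rw [hx, Option.some.injEq] at hx'
      subst hx'
      rw [hq, Option.some.injEq, Prod.mk.injEq] at hq'
      obtain ⟨rfl, rfl⟩ := hq'
      exact e
  | @next n p ρ i t x q b j u r hx hq hu hr' ih =>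
    rcases s with _ | ⟨m1, _ | ⟨m2, s⟩⟩
    · simp at hs
    · simp only [List.singleton_append, List.cons.injEq] at hr
      obtain ⟨_, e, _⟩ := hr
      cases h' with
      | answer hx' hq' =>
        rw [hx, Option.some.injEq] at hx'
        subst hx'
        rw [hq, Option.some.injEq, Prod.mk.injEq] at hq'
        obtain ⟨rfl, rfl⟩ := hq'
        exact e
      | next hx' hq' =>
        rw [hx, Option.some.injEq] at hx'
        subst hx'
        rw [hq, Option.some.injEq, Prod.mk.injEq] at hq'
        obtain ⟨rfl, rfl⟩ := hq'
        exact e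
    · simp only [List.cons_append, List.cons.injEq] at hr
      obtain ⟨rfl, rfl, rfl⟩ := hr
      have hs' : Odd s.length := by
        simp only [List.length_cons, Nat.odd_iff] at hs ⊢
        omega
      generalize hr : (p, Label.mk i (blackBoxes n t.tlams)) :: (q, ⟨b, t.body.tyArgs⟩) :: s ++ [m']
        = r at h'
      cases h' with
      | nil => simp at hr
      | enter => simp at hr
      | answer => simp at hr
      | @next _ _ _ _ _ x' q' b' j' u' r hx' hq' hu' hr'' =>
        simp only [List.cons_append, List.cons.injEq, true_and] at hr
        obtain ⟨_, rfl⟩ := hr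
        rcases s with _ | ⟨m3, s⟩
        · simp at hs'
        · have e := (hr'.cons_eq).symm.trans (hr''.cons_eq)
          simp only [Prod.mk.injEq, Label.mk.injEq] at e
          obtain rfl : j = j' := by omega
          obtain rfl := Option.some.inj (hu.symm.trans hu')
          exact ih hr'' hs' rfl

theorem finite_plays (n p : ℕ) (ρ : List (ℕ × ℕ)) (i : ℕ) (t : Tm) :
    {s | Plays n p ρ i t s}.Finite := by
  generalize hm : sizeOf t = m
  induction m using Nat.strong_induction_on generalizing n p ρ i t with
  | _ m ih =>
  set ρ' := binders (p + 1) t.lams ++ ρ with hρ'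
  have hfin : (⋃ qb ∈ ρ'.toFinset, ⋃ j ∈ Set.Iio t.body.tmArgs.length,
      ⋃ u ∈ {u | t.body.tmArgs[j]? = some u},
        (fun s => (p, Label.mk i (blackBoxes n t.tlams)) :: (qb.1, Label.mk qb.2 t.body.tyArgs) :: s) ''
          {s | Plays (n + t.tlams) (p + 2) ρ' (j + 1) u s}).Finite := by
    refine Set.Finite.biUnion ρ'.toFinset.finite_toSet fun qb _ =>
      Set.Finite.biUnion (Set.finite_Iio _) fun j _ => Set.Finite.biUnion ?_ fun u hu => ?_
    · exact Set.Subsingleton.finite fun u hu v hv => Option.some.inj (hu.symm.trans hv)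
    · refine (ih _ ?_ _ _ _ _ u rfl).image _
      rw [← hm]
      exact sizeOf_lt_of_mem_tmArgs_body (List.mem_of_getElem? hu)
  have hfin' : (⋃ qb ∈ ρ'.toFinset,
      {[(p, Label.mk i (blackBoxes n t.tlams)), (qb.1, Label.mk qb.2 t.body.tyArgs)]} :
        Set Dialogue).Finite :=
    Set.Finite.biUnion ρ'.toFinset.finite_toSet fun qb _ => Set.finite_singleton _
  refine (((Set.finite_singleton ([] : Dialogue)).union
    (Set.finite_singleton [(p, Label.mk i (blackBoxes n t.tlams))])).union
      (hfin'.union hfin)).subset ?_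
  rintro s hs
  cases hs with
  | nil => exact .inl (.inl rfl)
  | enter => exact .inl (.inr rfl)
  | @answer _ _ _ _ _ x q b hx hq =>
    refine .inr (.inl (Set.mem_biUnion (x := (q, b)) ?_ rfl))
    exact List.mem_toFinset.2 (List.mem_of_getElem? hq)
  | @next _ _ _ _ _ x q b j u s hx hq hu hs =>
    refine .inr (.inr (Set.mem_biUnion (x := (q, b)) ?_ (Set.mem_biUnion (x := j) ?_
      (Set.mem_biUnion (x := u) hu ⟨s, hs, rfl⟩))))
    · exact List.mem_toFinset.2 (List.mem_of_getElem? hq)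
    · exact lt_length_of_getElem? hu

end Tm

variable {T : Ty} {d : Dialogue} {st : ℕ → State} {n : ℕ} {ρ : List (ℕ × ℕ)} {Γ : List Ty} {i : ℕ}
  {A : Ty} {t : Tm} {s : Dialogue}

theorem CopycatStates.mono {N M : ℕ} (h : CopycatStates M st) (hN : N ≤ M) : CopycatStates N st :=
  fun j hj hjN => h j hj (hjN.trans hN)

/-- The plays of an `η`-long term are legal, and follow the copycat condition. -/
theorem Tm.Plays.legal (hs : Tm.Plays n d.length ρ i t s) (h : Config T d st n ρ Γ)
    (hA : (st d.length).entry T i = some A) (ht : EtaLong n Γ t A) :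
    ∃ st', Legal T (d ++ s) st' ∧ CopycatStates (d ++ s).length st' := by
  generalize hp : d.length = p at hs
  induction hs generalizing d st Γ A with
  | nil => exact ⟨st, by simpa using h.legal, by simpa using h.copycat⟩
  | enter =>
    subst hp
    obtain ⟨x, q, b, st', Γ', _, _, h', _⟩ := h.round_of_etaLong hA ht
    have hl := h'.legal
    rw [← List.singleton_append, ← List.append_assoc] at hl
    exact ⟨st', hl.prefix, h'.copycat.mono (by simp)⟩
  | answer hx hq =>
    subst hp
    obtain ⟨x, q, b, st', Γ', hx', hq', h', _⟩ := h.round_of_etaLong hA ht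
    rw [hx, Option.some.injEq] at hx'
    subst hx'
    rw [hq, Option.some.injEq, Prod.mk.injEq] at hq'
    obtain ⟨rfl, rfl⟩ := hq'
    exact ⟨st', h'.legal, h'.copycat⟩
  | next hx hq hu hs ih =>
    subst hp
    obtain ⟨x, q, b, st', Γ', hx', hq', h', hu', _⟩ := h.round_of_etaLong hA ht
    rw [hx, Option.some.injEq] at hx'
    subst hx'
    rw [hq, Option.some.injEq, Prod.mk.injEq] at hq'
    obtain ⟨rfl, rfl⟩ := hq'
    obtain ⟨C, hC, huC⟩ := hu' _ _ hu
    obtain ⟨st'', h1, h2⟩ := ih h' (by simpa using hC) huC (by simp)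
    exact ⟨st'', by simpa using h1, by simpa using h2⟩

theorem Tm.Plays.exists_answer (hs : Tm.Plays n d.length ρ i t s) (h : Config T d st n ρ Γ)
    (hA : (st d.length).entry T i = some A) (ht : EtaLong n Γ t A) (hodd : Odd s.length) :
    ∃ m, Tm.Plays n d.length ρ i t (s ++ [m]) := by
  generalize hp : d.length = p at hs
  induction hs generalizing d st Γ A with
  | nil => simp at hodd
  | enter =>
    subst hp
    obtain ⟨x, q, b, st', Γ', hx, hq, _⟩ := h.round_of_etaLong hA ht
    exact ⟨_, .answer hx hq⟩
  | answer hx hq => exact absurd hodd (by simp)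
  | next hx hq hu hs ih =>
    subst hp
    obtain ⟨x, q, b, st', Γ', hx', hq', h', hu', _⟩ := h.round_of_etaLong hA ht
    rw [hx, Option.some.injEq] at hx'
    subst hx'
    rw [hq, Option.some.injEq, Prod.mk.injEq] at hq'
    obtain ⟨rfl, rfl⟩ := hq'
    obtain ⟨C, hC, huC⟩ := hu' _ _ hu
    obtain ⟨m, hm⟩ := ih h' (by simpa using hC) huC
      (by simp only [List.length_cons, Nat.odd_iff] at hodd ⊢; omega) (by simp)
    exact ⟨m, .next hx hq hu hm⟩

theorem Config.plays_singleton (h : Config T d st n ρ Γ)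
    (hA : (st d.length).entry T i = some A) (ht : EtaLong n Γ t A) {m : ℕ × Label}
    (hm : d ++ [m] ∈ blackBoxGame T) (hi : m.2.branch = i) : Tm.Plays n d.length ρ i t [m] := by
  subst hi
  obtain ⟨S, _, _, _, _, hS, _⟩ := ht.decompose
  have e := h.unique_opponent hm hA hS
  rw [e]
  exact .enter

/-- After the answer, `O` can only choose branches of the state reached by `P`, and each of these
corresponds to a term argument. -/
theorem Config.plays_answer_concat (h : Config T d st n ρ Γ)
    (hA : (st d.length).entry T i = some A) (ht : EtaLong n Γ t A) {x q b : ℕ} {m : ℕ × Label}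
    (hx : t.body.headVar = some x)
    (hq : (Tm.binders (d.length + 1) t.lams ++ ρ)[x]? = some (q, b))
    (hm : d ++ [(d.length, ⟨i, blackBoxes n t.tlams⟩), (q, ⟨b, t.body.tyArgs⟩)] ++ [m] ∈
      blackBoxGame T) :
    Tm.Plays n d.length ρ i t
      ([(d.length, ⟨i, blackBoxes n t.tlams⟩), (q, ⟨b, t.body.tyArgs⟩)] ++ [m]) := by
  obtain ⟨x, q, b, st', Γ', hx', hq', h', hu', hu''⟩ := h.round_of_etaLong hA ht
  rw [hx, Option.some.injEq] at hx'
  subst hx'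
  rw [hq, Option.some.injEq, Prod.mk.injEq] at hq'
  obtain ⟨rfl, rfl⟩ := hq'
  obtain ⟨r, hr⟩ := h'.legal.exists_move hm
  obtain ⟨_, k, C, S, _, hC, _⟩ := h'.of_move_opponent hr
  simp only [List.length_append, List.length_cons, List.length_nil] at hC
  obtain ⟨j, u, hj, hu⟩ := hu'' _ _ hC
  obtain ⟨C', hC', huC⟩ := hu' j u hu
  have := h'.plays_singleton (i := j + 1) (by simpa using hC') huC hm hj
  simp only [List.length_append, List.length_cons, List.length_nil] at this
  exact .next hx hq hu this

/-- This gives liveness. The condition `hi` is needed since after `d` alone `O` might enter another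
branch than `i`. -/
theorem Tm.Plays.concat_of_even (hs : Tm.Plays n d.length ρ i t s) (h : Config T d st n ρ Γ)
    (hA : (st d.length).entry T i = some A) (ht : EtaLong n Γ t A) (heven : Even s.length)
    {m : ℕ × Label} (hm : d ++ s ++ [m] ∈ blackBoxGame T) (hi : s = [] → m.2.branch = i) :
    Tm.Plays n d.length ρ i t (s ++ [m]) := by
  generalize hp : d.length = p at hs
  induction hs generalizing d st Γ A with
  | nil =>
    subst hp
    exact h.plays_singleton hA ht (by simpa using hm) (hi rfl)
  | enter => exact absurd heven (by simp)
  | answer hx hq =>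
    subst hp
    exact h.plays_answer_concat hA ht hx hq hm
  | @next n p ρ i t x q b j u s hx hq hu hs ih =>
    subst hp
    by_cases hnil : s = []
    · subst hnil
      exact h.plays_answer_concat hA ht hx hq hm
    obtain ⟨x, q, b, st', Γ', hx', hq', h', hu', _⟩ := h.round_of_etaLong hA ht
    rw [hx, Option.some.injEq] at hx'
    subst hx'
    rw [hq, Option.some.injEq, Prod.mk.injEq] at hq'
    obtain ⟨rfl, rfl⟩ := hq'
    obtain ⟨C, hC, huC⟩ := hu' _ _ hu
    exact .next hx hq hu (ih h' (by simpa using hC) huC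
      (by simp only [List.length_cons, Nat.even_iff] at heven ⊢; omega) (by simpa using hm)
      (fun e => absurd e hnil) (by simp))

theorem strategy_mem_copycatStrategies (hT : T.IsClosed) (ht : t ∈ etaLongNormalTerms T) :
    t.strategy ∈ copycatStrategies T := by
  obtain ⟨h1, h2, h3⟩ := ht
  have hg : EtaLong 0 [] t T := ⟨h1, h2, h3⟩
  have hc := Config.init hT
  have hA : (State.star).entry T 1 = some T := rfl
  have hlegal : ∀ s ∈ t.strategy, ∃ st, Legal T s st ∧ CopycatStates s.length st := fun s hs => by
    simpa using Tm.Plays.legal (d := []) hs hc hA hg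
  refine ⟨⟨⟨.nil, fun s m hs => hs.of_concat⟩, fun s hs => ?_, fun s hs hodd => ?_⟩,
    fun s hs heven m hm => ?_, Tm.finite_plays _ _ _ _ _, fun s hs j hj hjs => ?_⟩
  · obtain ⟨st, hst, _⟩ := hlegal s hs
    exact hst.mem_blackBoxGame
  · obtain ⟨m, hm⟩ := Tm.Plays.exists_answer (d := []) hs hc hA hg hodd
    exact ⟨m, hm, fun m' hm' => Tm.Plays.concat_unique hm' hm hodd⟩
  · refine Tm.Plays.concat_of_even (d := []) hs hc hA hg heven hm ?_
    rintro rfl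
    -- The initial state admits the branch `1` only.
    obtain ⟨q, hq⟩ := hc.legal.exists_move hm
    obtain ⟨_, k, C, S, _, hC, _⟩ := hc.of_move_opponent hq
    simp only [State.entry] at hC
    by_contra hne
    simp [hne] at hC
  · obtain ⟨st, hst, hcopy⟩ := hlegal s hs
    obtain ⟨X, S, S', h1, h2, h3, h4⟩ := hcopy j hj hjs
    exact ⟨X, (hst.hasColour (by omega)).2 ⟨S, h1, h2⟩, (hst.hasColour hjs).2 ⟨S', h3, h4⟩⟩

/-- `η`-long terms of the same type with the same plays are equal. -/
theorem EtaLong.eq_of_plays_iff {n p : ℕ} {ρ : List (ℕ × ℕ)} {Γ : List Ty} {i : ℕ} {t t' : Tm}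
    {A : Ty} (ht : EtaLong n Γ t A) (ht' : EtaLong n Γ t' A) (hlen : ρ.length = Γ.length)
    (hnodup : ρ.Nodup) (hρ : ∀ qb ∈ ρ, qb.1 ≤ p)
    (h : ∀ s, Tm.Plays n p ρ i t s ↔ Tm.Plays n p ρ i t' s) : t = t' := by
  generalize hm : sizeOf t = m
  induction m using Nat.strong_induction_on generalizing n p ρ Γ i t t' A with
  | _ m ih =>
  obtain ⟨S, X, x, B, S', hS, hl, hX, hx, hB, hV, hS', hX', hlen', hu⟩ := ht.decompose
  obtain ⟨S₁, X₁, x₁, B₁, S₁', hS₁, hl₁, hX₁, hx₁, hB₁, hV₁, hS₁', hX₁', hlen₁', hu₁⟩ :=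
    ht'.decompose
  have hk := resolve_blackBoxes_unique hS hS₁
  rw [← hk] at hS₁ hu₁
  obtain rfl := Option.some.inj (hS.symm.trans hS₁)
  set ρ' := Tm.binders (p + 1) S.branches.length ++ ρ with hρ'
  have hlenρ : ρ'.length = (S.branches.reverse ++ Γ).length := by simp [hρ', hlen]
  -- New entries point to position `p + 1`, old ones to at most `p`. Without repetitions, a pointer
  -- and a branch determine the head variable.
  have hnodup' : ρ'.Nodup := by
    refine List.Nodup.append ?_ hnodup ?_
    · refine List.Nodup.map (fun a b hab => ?_) (List.nodup_reverse.2 List.nodup_range)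
      simpa using hab
    · intro qb h1 h2
      have := hρ qb h2
      simp only [Tm.binders, List.mem_map] at h1
      obtain ⟨b, _, rfl⟩ := h1
      simp only at this
      omega
  have hρ2 : ∀ qb ∈ ρ', qb.1 ≤ p + 2 := by
    intro qb hqb
    rcases List.mem_append.1 hqb with h1 | h1
    · simp only [Tm.binders, List.mem_map] at h1
      obtain ⟨b, _, rfl⟩ := h1
      simp
    · exact (hρ qb h1).trans (by omega)
  obtain ⟨⟨q, b⟩, hq⟩ : ∃ qb, ρ'[x]? = some qb :=
    ⟨_, List.getElem?_eq_getElem (hlenρ ▸ lt_length_of_getElem? hB)⟩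
  have hq' : (Tm.binders (p + 1) t.lams ++ ρ)[x]? = some (q, b) := hl ▸ hq
  -- The answer of `t` is also a play of `t'`, so both have the same head variable and type
  -- arguments.
  have hans := (h _).1 (.answer hx hq')
  obtain ⟨hxx, hVV⟩ : x₁ = x ∧ t.body.tyArgs = t'.body.tyArgs := by
    generalize hr : [(p, Label.mk i (blackBoxes n t.tlams)), (q, Label.mk b t.body.tyArgs)] = r
      at hans
    have key : ∀ {y q' b'}, t'.body.headVar = some y →
        (Tm.binders (p + 1) t'.lams ++ ρ)[y]? = some (q', b') → q = q' → b = b' → x₁ = x := by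
      rintro y q' b' hy hq'' rfl rfl
      obtain rfl := Option.some.inj (hx₁.symm.trans hy)
      rw [← hl₁] at hq''
      exact (List.getElem?_inj (hlenρ ▸ lt_length_of_getElem? hB₁) hnodup').1 (hq''.trans hq.symm)
    cases hans with
    | nil => simp at hr
    | enter => simp at hr
    | answer hy hq'' =>
      simp only [List.cons.injEq, Prod.mk.injEq, Label.mk.injEq, true_and, and_true] at hr
      exact ⟨key hy hq'' hr.2.1 hr.2.2.1, hr.2.2.2⟩
    | next hy hq'' =>
      simp only [List.cons.injEq, Prod.mk.injEq, Label.mk.injEq, true_and] at hr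
      exact ⟨key hy hq'' hr.2.1.1 hr.2.1.2.1, hr.2.1.2.2⟩
  subst hxx
  obtain rfl := Option.some.inj (hB.symm.trans hB₁)
  rw [← hVV] at hS₁'
  obtain rfl := Option.some.inj (hS'.symm.trans hS₁')
  refine ht.eq_of_args_eq ht' (hx.trans hx₁.symm) hVV ?_
  refine List.ext_getElem? fun j => ?_
  rcases Nat.lt_or_ge j S'.branches.length with hj | hj
  swap
  · rw [List.getElem?_eq_none (by omega), List.getElem?_eq_none (by omega)]
  obtain ⟨u, hu2⟩ : ∃ u, t.body.tmArgs[j]? = some u := ⟨_, List.getElem?_eq_getElem (by omega)⟩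
  obtain ⟨u', hu2'⟩ : ∃ u, t'.body.tmArgs[j]? = some u := ⟨_, List.getElem?_eq_getElem (by omega)⟩
  rw [hu2, hu2', Option.some.injEq]
  obtain ⟨C, hC, huC⟩ := hu j u hu2
  obtain ⟨C', hC', huC'⟩ := hu₁ j u' hu2'
  obtain rfl := Option.some.inj (hC.symm.trans hC')
  have hq₁ : (Tm.binders (p + 1) t'.lams ++ ρ)[x₁]? = some (q, b) := hl₁ ▸ hq
  -- The non-empty plays of the `j`-th argument are recovered from those of the whole term: they are
  -- the continuations after the answer that begin with branch `j + 1`.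
  have hnext : ∀ {t u : Tm} {s}, t.body.headVar = some x₁ → S.branches.length = t.lams →
      t.body.tmArgs[j]? = some u → (Tm.Plays (n + t.tlams) (p + 2) ρ' (j + 1) u s ↔
        s = [] ∨ s ≠ [] ∧ Tm.Plays n p ρ i t ((p, ⟨i, blackBoxes n t.tlams⟩) ::
          (q, ⟨b, t.body.tyArgs⟩) :: s) ∧ ∃ m s', s = m :: s' ∧ m.2.branch = j + 1) := by
    intro t u s hx hl hu
    have hq' : (Tm.binders (p + 1) t.lams ++ ρ)[x₁]? = some (q, b) := hl ▸ hq
    constructor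
    · intro hs
      cases s with
      | nil => exact .inl rfl
      | cons m s =>
        refine .inr ⟨by simp, .next hx hq' hu (by rw [← hl]; exact hs), m, s, rfl, ?_⟩
        rw [hs.cons_eq]
    · rintro (rfl | ⟨hne, hs, m, s', rfl, hbr⟩)
      · exact .nil
      · cases hs with
        | next hx' hq'' hu' hs' =>
          rw [← hl] at hs'
          have e := hs'.cons_eq
          rw [e] at hbr
          simp only [add_left_inj] at hbr
          subst hbr
          obtain rfl := Option.some.inj (hu.symm.trans hu')
          exact hs'
  refine ih (sizeOf u) ?_ huC huC' hlenρ hnodup' hρ2 (i := j + 1) (fun s => ?_) rfl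
  · rw [← hm]
    exact Tm.sizeOf_lt_of_mem_tmArgs_body (List.mem_of_getElem? hu2)
  · have e1 := hnext (s := s) hx hl hu2
    have e2 := hnext (s := s) hx₁ hl₁ hu2'
    rw [← hk, ← hVV] at e2
    rw [e1, e2, h]

end

section

/-! ### The term of a strategy -/

variable {T : Ty} {σ : Set Dialogue}

theorem mem_of_append_mem (hσ : IsTree σ) {d e : Dialogue} (h : d ++ e ∈ σ) : d ∈ σ := by
  induction e using List.reverseRecOn with
  | nil => simpa using h
  | append_singleton e m ih => exact ih (hσ.2 _ m (by rwa [← List.append_assoc] at h))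

/-- A finite copycat strategy plays according to a term whenever `O` enters a type. -/
theorem exists_etaLong_plays (hσ : σ ∈ copycatStrategies T) {N : ℕ} (hN : ∀ d ∈ σ, d.length ≤ N)
    {d : Dialogue} {st : ℕ → State} {n : ℕ} {ρ : List (ℕ × ℕ)} {Γ : List Ty}
    (h : Config T d st n ρ Γ) (hd : d ∈ σ) {i : ℕ} {A : Ty}
    (hA : (st d.length).entry T i = some A) :
    ∃ t, EtaLong n Γ t A ∧ ∀ s, Tm.Plays n d.length ρ i t s ↔
      s = [] ∨ d ++ s ∈ σ ∧ ∃ m s', s = m :: s' ∧ m.2.branch = i := by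
  obtain ⟨⟨htree, hsub, hstrat⟩, hlive, hfin, hcopy⟩ := hσ
  -- Each round lengthens the dialogue by two moves, and no dialogue in `σ` is longer than `N`.
  generalize hm : N - d.length = r
  induction r using Nat.strong_induction_on generalizing d st n ρ Γ i A with
  | _ r ih =>
  obtain ⟨k, S, X, hS, hX, hbuild⟩ := exists_etaLong (h.wf_entry i A hA)
  set m₁ : ℕ × Label := (d.length, ⟨i, blackBoxes n k⟩) with hm₁
  have hl₁ := h.legal.extend (h.move_opponent hA hS)
  -- Liveness puts the move of `O` into `σ`; the strategy then supplies a unique answer.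
  have hd₁ : d ++ [m₁] ∈ σ := hlive d hd h.even _ hl₁.mem_blackBoxGame
  obtain ⟨⟨a, l⟩, hd₂, huniq⟩ := hstrat _ hd₁ (by simpa using h.even.add_one)
  have hp := h.even
  obtain ⟨q, hq⟩ := hl₁.exists_move (hsub hd₂)
  obtain ⟨A', S', hA', hS', rfl⟩ := hyper_step.1 hq.step
  have hl₂ := hl₁.extend hq
  -- The copycat condition provides the equality of colours that makes the body well typed.
  have hX' : S'.colour = some X := by
    obtain ⟨Y, h1, h2⟩ := hcopy _ hd₂ (d.length + 1) (by simpa [Nat.even_add_one] using h.even)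
      (by simp)
    obtain ⟨B, hB, hY⟩ := (hl₂.hasColour (by simp)).1 h1
    obtain ⟨B', hB', hY'⟩ := (hl₂.hasColour (by simp)).1 h2
    simp only [List.length_append, List.length_singleton] at hB hB'
    rw [Function.update_of_ne (by omega), Function.update_self] at hB
    rw [Function.update_self] at hB'
    cases hB
    cases hB'
    rw [hY', ← hY, hX]
  have hc := h.round hA hS hX hX' hq
  set ρ' := Tm.binders (d.length + 1) S.branches.length ++ ρ with hρ'
  have hSwf : S.WF (n + k) :=
    ((h.wf_entry i A hA).mono (by omega)).impAll (fun V hV => WF_of_mem_blackBoxes hV)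
      (Ty.resolve_eq_some.1 hS).2.1
  have hscope := h.scope.push h.even hSwf
  have ha := hq.le
  have ho := hq.odd
  rw [List.length_append, List.length_singleton] at ha ho
  have hodd : Odd a := by
    rw [Nat.odd_iff] at ho ⊢
    rw [Nat.even_iff] at hp
    omega
  obtain ⟨x, hx⟩ := hscope.complete a l.branch A' hodd ha hA'
  have hxΓ := (hscope.lookup x _ _ hx).2.2
  rw [hA'] at hxΓ
  have himp : oImports (d ++ [m₁]) = blackBoxes 0 (n + k) := by
    rw [oImports_append h.even, h.imports, blackBoxes_add, Nat.zero_add]; rfl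
  have hV : ∀ V ∈ l.imports, V.WF (n + k) := by
    refine fun V hV => ⟨(Ty.resolve_eq_some.1 hS').1 V hV, fun y hy => ?_⟩
    have := hq.proponent (by simpa [Nat.even_add_one] using h.even) V hV y hy
    rwa [himp, fvar_mem_blackBoxes_zero] at this
  have hd₂' : d ++ [m₁, (a, l)] ∈ σ := by simpa using hd₂
  have hbound := hN _ hd₂'
  simp only [List.length_append, List.length_cons, List.length_nil] at hbound
  -- The induction hypothesis yields one argument term for each branch of the state reached by `P`.
  have hu : ∀ j : Fin S'.branches.length, ∃ u, EtaLong (n + k) (S.branches.reverse ++ Γ) u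
      S'.branches[j] ∧ ∀ s, Tm.Plays (n + k) (d.length + 2) ρ' (j + 1) u s ↔
      s = [] ∨ d ++ [m₁, (a, l)] ++ s ∈ σ ∧ ∃ m s', s = m :: s' ∧ m.2.branch = j + 1 := by
    intro j
    obtain ⟨u, hu, hs⟩ := ih (N - (d.length + 2)) (by omega) hc hd₂' (i := j + 1)
      (A := S'.branches[j]) (by simp [State.entry_ty_succ]) (by simp)
    exact ⟨u, hu, by simpa using hs⟩
  choose u hu hplays using hu
  obtain ⟨t, ht, hk, hlams, hhead, hty, htm⟩ := hbuild Γ x A' l.imports S' (List.ofFn u) hxΓ hV hS'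
    hX' (by simp) (by
      intro j v C hv hC
      obtain ⟨hj, rfl⟩ := List.getElem?_eq_some_iff.1 hv
      obtain ⟨hj', rfl⟩ := List.getElem?_eq_some_iff.1 hC
      simpa using hu ⟨j, hj'⟩)
  have hx' : (Tm.binders (d.length + 1) t.lams ++ ρ)[x]? = some (a, l.branch) := by rw [hlams, hx]
  have hm₁' : (d.length, Label.mk i (blackBoxes n t.tlams)) = m₁ := by rw [hk]
  refine ⟨t, ht, fun s => ⟨fun hs => ?_, ?_⟩⟩
  · cases hs with
    | nil => exact .inl rfl
    | enter => exact .inr ⟨by rwa [hm₁'], _, _, rfl, rfl⟩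
    | answer hy hy' =>
      obtain rfl := Option.some.inj (hhead.symm.trans hy)
      rw [hx', Option.some.injEq, Prod.mk.injEq] at hy'
      obtain ⟨rfl, rfl⟩ := hy'
      exact .inr ⟨by rw [hm₁', hty]; exact hd₂', _, _, rfl, rfl⟩
    | @next _ _ _ _ _ _ _ _ j v s hy hy' hv hs =>
      obtain rfl := Option.some.inj (hhead.symm.trans hy)
      rw [hx', Option.some.injEq, Prod.mk.injEq] at hy'
      obtain ⟨rfl, rfl⟩ := hy'
      refine .inr ⟨?_, _, _, rfl, rfl⟩
      rw [htm] at hv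
      obtain ⟨hj, rfl⟩ := List.getElem?_eq_some_iff.1 hv
      rw [List.length_ofFn] at hj
      rw [hk, hlams] at hs
      rw [hm₁', hty]
      rcases (hplays ⟨j, hj⟩ s).1 (by simpa using hs) with rfl | ⟨h1, _⟩
      · exact hd₂'
      · simpa using h1
  · rintro (rfl | ⟨hs, m, s, rfl, hi⟩)
    · exact .nil
    have hmσ : d ++ [m] ∈ σ := mem_of_append_mem htree (e := s) (by simpa using hs)
    have hm' := h.unique_opponent (hsub hmσ) (by rw [hi]; exact hA) hS
    rw [hi] at hm'
    rw [hm'] at hs ⊢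
    rw [← hm₁, ← hm₁']
    rcases s with _ | ⟨m', s⟩
    · exact .enter
    have hmσ' : d ++ [m₁] ++ [m'] ∈ σ := mem_of_append_mem htree (e := s) (by simpa using hs)
    obtain rfl := huniq m' hmσ'
    have hal : ((a, l) : ℕ × Label) = (a, ⟨l.branch, t.body.tyArgs⟩) := by rw [hty]
    rw [hal]
    rcases s with _ | ⟨m₃, s⟩
    · exact .answer hhead hx'
    have hmσ₃ : d ++ [m₁, (a, l)] ++ [m₃] ∈ σ :=
      mem_of_append_mem htree (e := s) (by simpa using hs)
    obtain ⟨q, hq₃⟩ := hc.legal.exists_move (hsub hmσ₃)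
    obtain ⟨_, _, C, _, _, hC, _⟩ := hc.of_move_opponent hq₃
    simp only [List.length_append, List.length_cons, List.length_nil, Nat.zero_add, Nat.reduceAdd,
      Function.update_self] at hC
    obtain ⟨j, hj, hjC⟩ := State.entry_ty hC
    have hjlt := lt_length_of_getElem? hjC
    refine .next hhead hx' (j := j) (u := u ⟨j, hjlt⟩) ?_ ?_
    · rw [htm]
      simp [hjlt]
    · rw [hk, hlams]
      exact (hplays ⟨j, hjlt⟩ _).2 (.inr ⟨by simpa using hs, _, _, rfl, hj⟩)

theorem exists_strategy_eq (hT : T.IsClosed) (hσ : σ ∈ copycatStrategies T) :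
    ∃ t ∈ etaLongNormalTerms T, t.strategy = σ := by
  have hσ' := hσ
  obtain ⟨⟨htree, hsub, _⟩, _, hfin, _⟩ := hσ'
  obtain ⟨N, hN⟩ := (hfin.image List.length).bddAbove
  have hc := Config.init hT
  obtain ⟨t, ht, hplays⟩ := exists_etaLong_plays hσ (fun d hd => hN ⟨d, hd, rfl⟩) hc htree.1
    (i := 1) (A := T) rfl
  refine ⟨t, ⟨ht.hasType, ht.betaNormal, ht.etaExpanded⟩, Set.ext fun s => ?_⟩
  refine (hplays s).trans ⟨?_, fun hs => ?_⟩
  · rintro (rfl | ⟨hs, _⟩)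
    exacts [htree.1, hs]
  -- The restriction to branch `1` is vacuous here, as the initial state has no other branch.
  · rcases s with _ | ⟨m, s⟩
    · exact .inl rfl
    refine .inr ⟨hs, m, s, rfl, ?_⟩
    have hm : [] ++ [m] ∈ σ := mem_of_append_mem htree (e := s) hs
    obtain ⟨q, hq⟩ := hc.legal.exists_move (hsub hm)
    obtain ⟨_, _, C, _, _, hC, _⟩ := hc.of_move_opponent hq
    simp only [State.entry] at hC
    by_contra hne
    simp [hne] at hC

end

end SystemF

theorem theorem3 (T : SystemF.Ty) (hT : T.IsClosed) :
    Set.BijOn SystemF.Tm.strategy (SystemF.etaLongNormalTerms T) (SystemF.copycatStrategies T) := by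
  refine ⟨fun t ht => SystemF.strategy_mem_copycatStrategies hT ht, fun t ht t' ht' h => ?_,
    fun σ hσ => SystemF.exists_strategy_eq hT hσ⟩
  have h1 : SystemF.EtaLong 0 [] t T := ⟨ht.1, ht.2.1, ht.2.2⟩
  have h2 : SystemF.EtaLong 0 [] t' T := ⟨ht'.1, ht'.2.1, ht'.2.2⟩
  exact h1.eq_of_plays_iff h2 rfl List.nodup_nil (by simp) (fun s => Set.ext_iff.1 h s)
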